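/- All graphs are finite and simple, and $\alpha(G)$ denotes the independence number of $G$. For integers $t,m$ let $R(t,m)$ be the least $n$ such that every graph on $n$ vertices contains a clique $K_t$ or an independent set of size $m$. For $t\ge 2$ let $Q(t,n)$ be the minimum of $\alpha(G)$ over all $K_t$-free graphs $G$ on $n$ vertices. For a graph $H$ and a real number $x$ let $\mathrm{RT}(n,H,x)$ be the maximum number of edges of an $H$-free graph on $n$ vertices with independence number less than $x$ (and $0$ if no such graph exists). For a function $f:\mathbb N\to\mathbb R$ put $$\overline{\mathrm{RT}}(H,f)=\limsup_{n\to\infty}\frac{\mathrm{RT}(n,H,f(n))}{n^2},\qquad \underline{\mathrm{RT}}(H,f)=\liminf_{n\to\infty}\frac{\mathrm{RT}(n,H,f(n))}{n^2}.$$ For functions $f,g$ with $g(n)\le f(n)$ for all sufficiently large $n$, we say that $H$ has a *phase transition from $f$ to $g$* if $\overline{\mathrm{RT}}(H,g)<\underline{\mathrm{RT}}(H,f)$. We say that $H$ has a *strong phase transition at $f$* if $H$ has a phase transition from $f$ to $\varphi f$ for every function $\varphi:\mathbb N\to\mathbb R$ with $\varphi(n)\to 0$ as $n\to\infty$. For an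 integer $\ell\ge 2$ let $\mathrm{C}(\ell)$ be the assertion that there exist $\vartheta>0$ and $N>0$ such that for all $n>N$ $$R(\ell-1,n)\le \frac{R(\ell,n)}{n^{\vartheta}}.$$ (It is conjectured that $\mathrm{C}(\ell)$ holds for every $\ell\ge 3$; $\mathrm{C}(2)$ holds trivially, since $R(1,n)=1$ and $R(2,n)=n$ for $n\ge1$.) **Theorem.** Let $t\ge 2$ and $s\ge 0$ be integers and assume that $\mathrm{C}(t)$ and $\mathrm{C}(t+1)$ hold. If $K_s$ has a phase transition from $Q(t,n)$ to $Q(t+1,n)$, then $K_s$ has a strong phase transition at $Q(t,n)$. -/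

import Mathlib

open Filter Topology

namespace RamseyTuran

/-- The Ramsey number `R(t, m)`: the least `n` such that every graph on `n` vertices contains
a clique on `t` vertices or an independent set of `m` vertices. -/
noncomputable def ramseyNumber (t m : ℕ) : ℕ :=
  sInf {n : ℕ | ∀ G : SimpleGraph (Fin n), ¬ G.CliqueFree t ∨ ¬ G.IndepSetFree m}

/-- The inverse Ramsey function `Q(t, n)`: the minimum independence number of the `K_t`-free
graphs on `n` vertices (such graphs exist for all `n` when `2 ≤ t`). -/
noncomputable def Q (t n : ℕ) : ℕ :=
  sInf {a : ℕ | ∃ G : SimpleGraph (Fin n), G.CliqueFree t ∧ G.indepNum = a}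

/-- The Ramsey–Turán function `RT(n, H, x)`: the maximum number of edges of an `H`-free graph on
`n` vertices with independence number less than `x`; it is `0` if there is no such graph. -/
noncomputable def RT {W : Type*} (n : ℕ) (H : SimpleGraph W) (x : ℝ) : ℕ :=
  sSup {e : ℕ | ∃ G : SimpleGraph (Fin n),
    H.Free G ∧ (G.indepNum : ℝ) < x ∧ G.edgeSet.ncard = e}

/-- The upper Ramsey–Turán density of `H` with respect to `f`. -/
noncomputable def upperDensity {W : Type*} (H : SimpleGraph W) (f : ℕ → ℝ) : ℝ :=
  limsup (fun n : ℕ => (RT n H (f n) : ℝ) / (n : ℝ) ^ 2) atTop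

/-- The lower Ramsey–Turán density of `H` with respect to `f`. -/
noncomputable def lowerDensity {W : Type*} (H : SimpleGraph W) (f : ℕ → ℝ) : ℝ :=
  liminf (fun n : ℕ => (RT n H (f n) : ℝ) / (n : ℝ) ^ 2) atTop

/-- `H` has a phase transition from `f` to `g`, where `g n ≤ f n` for all large `n`. -/
def HasPhaseTransition {W : Type*} (H : SimpleGraph W) (f g : ℕ → ℝ) : Prop :=
  (∀ᶠ n in atTop, g n ≤ f n) ∧ upperDensity H g < lowerDensity H f

/-- `H` has a strong phase transition at `f`: for every `φ` tending to `0`, it has a phase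
transition from `f` to `φ f`. -/
def HasStrongPhaseTransition {W : Type*} (H : SimpleGraph W) (f : ℕ → ℝ) : Prop :=
  ∀ φ : ℕ → ℝ, Tendsto φ atTop (𝓝 0) → HasPhaseTransition H f (fun n => φ n * f n)

/-- The polynomial-gap conjecture for Ramsey numbers at the integer `ℓ`:
`R(ℓ - 1, n) ≤ R(ℓ, n) / n ^ ϑ` for some `ϑ > 0` and all large `n`. -/
def RamseyGapConjecture (ℓ : ℕ) : Prop :=
  ∃ ϑ : ℝ, 0 < ϑ ∧ ∃ N : ℕ, 0 < N ∧ ∀ n : ℕ, N < n →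
    (ramseyNumber (ℓ - 1) n : ℝ) ≤ (ramseyNumber ℓ n : ℝ) / (n : ℝ) ^ ϑ

end RamseyTuran

namespace RamseyTuran

/-! For `k ≥ 2` and `k (t - 1) < s ≤ (k + 1) (t - 1)`, `C(t)` pins the density of `K_s` at `Q(t, n)`
to the Turán value `(1 - 1/k)/2`. For the lower bound, join `k` extremal `K_t`-free graphs on about
`n/k` vertices; `C(t)` makes `Q(t, ⌊n/k⌋ + 1)` strictly smaller than `Q(t, n)`
(`eventually_Q_div_lt`). For the upper bound, `C(t)` puts a `K_{t-1}` into every set of `n^(1-ε)`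
vertices. A denser graph has a linear-sized subgraph of large minimum degree, hence about `N^(k+1)`
ordered `(k+1)`-cliques, and iterated dependent random choice blows one of them up to a clique on
`(k+1)(t-1)` vertices (`exists_isNClique_mul_of_many_cliqueTuples`).

A phase transition from `Q(t, n)` to `Q(t+1, n)` gives two things. The density at `Q(t, n)` is
positive, so `s > 2 (t - 1)` and some such `k` exists. Also `s ≤ k t`: otherwise, by `C(t+1)`, the
join construction for `t + 1` reaches `(1 - 1/k)/2` already at `Q(t+1, n)`.

Below `φ(n) Q(t, n)` with `φ → 0`, subadditivity of `Q` puts a `K_t` into every linear-sized set.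
Near the Turán density, either there are many `(k+1)`-cliques, giving a clique on `(k+1)(t-1) ≥ s`
vertices, or stability yields `k` almost completely joined parts of size about `N/k`
(`exists_almost_complete_parts`); a `K_t` chosen greedily from each gives a clique on `k t ≥ s`
vertices. So the density drops strictly. -/

variable {V W : Type*}

/-! ### Ramsey numbers: recursion and a polynomial bound -/

/-- Every graph on `n` vertices has a `t`-clique or an independent `m`-set. -/
def IsRamsey (t m n : ℕ) : Prop :=
  ∀ G : SimpleGraph (Fin n), ¬ G.CliqueFree t ∨ ¬ G.IndepSetFree m

theorem IsRamsey.exists_subset {t m n : ℕ} (h : IsRamsey t m n) (G : SimpleGraph V)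
    (U : Finset V) (hU : n ≤ U.card) :
    (∃ C ⊆ U, G.IsNClique t C) ∨ (∃ I ⊆ U, G.IsNIndepSet m I) := by
  obtain ⟨U', hU', hc⟩ := Finset.exists_subset_card_eq hU
  let e : Fin n ↪ V := (U'.equivFinOfCardEq hc).symm.toEmbedding.trans (.subtype _)
  have he : ∀ i, e i ∈ U := fun i => hU' ((U'.equivFinOfCardEq hc).symm i).2
  rcases h (G.comap e) with h | h
  · left
    simp only [SimpleGraph.CliqueFree, not_forall, not_not] at h
    obtain ⟨C, hC⟩ := h
    refine ⟨C.map e, ?_, ?_, by simpa using hC.2⟩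
    · intro x hx
      obtain ⟨i, -, rfl⟩ := Finset.mem_map.1 hx
      exact he i
    · intro x hx y hy hxy
      obtain ⟨i, hi, rfl⟩ := Finset.mem_map.1 hx
      obtain ⟨j, hj, rfl⟩ := Finset.mem_map.1 hy
      exact hC.1 hi hj (fun h => hxy (by rw [h]))
  · right
    simp only [SimpleGraph.IndepSetFree, not_forall, not_not] at h
    obtain ⟨C, hC⟩ := h
    refine ⟨C.map e, ?_, ?_, by simpa using hC.2⟩
    · intro x hx
      obtain ⟨i, -, rfl⟩ := Finset.mem_map.1 hx
      exact he i
    · intro x hx y hy hxy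
      obtain ⟨i, hi, rfl⟩ := Finset.mem_map.1 hx
      obtain ⟨j, hj, rfl⟩ := Finset.mem_map.1 hy
      exact hC.1 hi hj (fun h => hxy (by rw [h]))

/-- The Erdős–Szekeres argument: a vertex splits the other `a + b - 1` into neighbours and
non-neighbours, so one class has at least `a` or at least `b` members. -/
theorem IsRamsey.add {t m a b : ℕ} (ha : IsRamsey t (m + 1) a) (hb : IsRamsey (t + 1) m b)
    (hab : 0 < a + b) : IsRamsey (t + 1) (m + 1) (a + b) := by
  classical
  intro G
  let v : Fin (a + b) := ⟨0, hab⟩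
  let A := Finset.univ.filter (fun x => G.Adj v x)
  let B := Finset.univ.filter (fun x => x ≠ v ∧ ¬ G.Adj v x)
  have hAB : A.card + B.card + 1 = a + b := by
    have h1 := Finset.card_filter_add_card_filter_not
      (s := (Finset.univ : Finset (Fin (a + b))).erase v) (p := fun x => G.Adj v x)
    rw [Finset.card_erase_of_mem (Finset.mem_univ v), Finset.card_univ, Fintype.card_fin] at h1
    have e1 : (Finset.univ.erase v).filter (fun x => G.Adj v x) = A := by
      ext x
      simp only [A, Finset.mem_filter, Finset.mem_erase, Finset.mem_univ, and_true, true_and,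
        and_iff_right_iff_imp]
      exact fun h => h.ne'
    have e2 : (Finset.univ.erase v).filter (fun x => ¬ G.Adj v x) = B := by
      ext x
      simp [B]
    rw [e1, e2] at h1
    omega
  have key : (∃ C, G.IsNClique (t + 1) C) ∨ (∃ I, G.IsNIndepSet (m + 1) I) := by
    by_cases h : a ≤ A.card
    · rcases ha.exists_subset G A h with ⟨C, hC, hC'⟩ | ⟨I, -, hI⟩
      · exact Or.inl ⟨insert v C, hC'.insert fun x hx => (Finset.mem_filter.1 (hC hx)).2⟩
      · exact Or.inr ⟨I, hI⟩
    · rcases hb.exists_subset G B (by omega) with ⟨C, -, hC⟩ | ⟨I, hI, hI'⟩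
      · exact Or.inl ⟨C, hC⟩
      · right
        refine ⟨insert v I, ?_⟩
        rw [← SimpleGraph.isNClique_compl] at hI' ⊢
        refine hI'.insert fun x hx => ?_
        have := (Finset.mem_filter.1 (hI hx)).2
        exact ⟨this.1.symm, this.2⟩
  rcases key with ⟨C, hC⟩ | ⟨I, hI⟩
  · exact Or.inl hC.not_cliqueFree
  · exact Or.inr fun h => h I hI

/-- Double induction on the recursion. Existence matters as much as the bound: it ensures that the
infimum defining `ramseyNumber` is attained. -/
theorem exists_isRamsey_le_pow (t m : ℕ) : ∃ n ≤ m ^ t, IsRamsey t m n := by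
  induction t generalizing m with
  | zero => exact ⟨0, by simp, fun G => Or.inl SimpleGraph.not_cliqueFree_zero⟩
  | succ t iht =>
    induction m with
    | zero => exact ⟨0, by simp, fun G => Or.inr fun h =>
        h ∅ (by simp [SimpleGraph.isNIndepSet_iff])⟩
    | succ m ihm =>
      rcases Nat.eq_zero_or_pos t with rfl | ht
      · refine ⟨1, by simp, fun G => Or.inl ?_⟩
        rw [zero_add, SimpleGraph.cliqueFree_one]
        exact fun h => h.false 0
      obtain ⟨a, ha, ha'⟩ := iht (m + 1)
      obtain ⟨b, hb, hb'⟩ := ihm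
      have hapos : 0 < a := by
        rcases Nat.eq_zero_or_pos a with rfl | h
        · rcases ha' ⊥ with h | h
          · refine absurd (SimpleGraph.cliqueFree_of_card_lt ?_) h
            rwa [Fintype.card_fin]
          · rw [← SimpleGraph.cliqueFree_compl] at h
            refine absurd (SimpleGraph.cliqueFree_of_card_lt ?_) h
            rw [Fintype.card_fin]
            exact m.succ_pos
        · exact h
      refine ⟨a + b, ?_, ha'.add hb' (by omega)⟩
      calc a + b ≤ (m + 1) ^ t + m ^ t * m := by rw [← pow_succ]; omega
        _ ≤ (m + 1) ^ t + (m + 1) ^ t * m := by gcongr; omega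
        _ = (m + 1) ^ (t + 1) := by ring

theorem isRamsey_ramseyNumber (t m : ℕ) : IsRamsey t m (ramseyNumber t m) := by
  obtain ⟨n, -, h⟩ := exists_isRamsey_le_pow t m
  exact Nat.sInf_mem (s := {n : ℕ | IsRamsey t m n}) ⟨n, h⟩

theorem IsRamsey.ramseyNumber_le {t m n : ℕ} (h : IsRamsey t m n) : ramseyNumber t m ≤ n :=
  Nat.sInf_le h

theorem ramseyNumber_le_pow (t m : ℕ) : ramseyNumber t m ≤ m ^ t := by
  obtain ⟨n, hn, h⟩ := exists_isRamsey_le_pow t m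
  exact h.ramseyNumber_le.trans hn

theorem ramseyNumber_pos {t m : ℕ} (ht : 0 < t) (hm : 0 < m) : 0 < ramseyNumber t m := by
  by_contra h
  have h0 : ramseyNumber t m = 0 := by omega
  rcases (isRamsey_ramseyNumber t m).exists_subset (⊥ : SimpleGraph ℕ) ∅ (by simp [h0]) with
    ⟨C, hC, hC'⟩ | ⟨C, hC, hC'⟩
  · rw [Finset.subset_empty] at hC
    subst hC
    have := hC'.2
    simp at this
    omega
  · rw [Finset.subset_empty] at hC
    subst hC
    have := hC'.2
    simp at this
    omega

theorem ramseyNumber_succ_le {t : ℕ} (ht : 0 < t) (m : ℕ) :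
    ramseyNumber (t + 1) (m + 1) ≤ ramseyNumber t (m + 1) + ramseyNumber (t + 1) m :=
  ((isRamsey_ramseyNumber t (m + 1)).add (isRamsey_ramseyNumber (t + 1) m)
    (by exact Nat.add_pos_left (ramseyNumber_pos ht m.succ_pos) _)).ramseyNumber_le

/-- A set of `ramseyNumber t m` vertices in a graph with independence number below `m` contains a
`t`-clique. -/
theorem exists_isNClique_of_indepNum_lt [Finite V] {G : SimpleGraph V} {t m : ℕ}
    (hG : G.indepNum < m) (U : Finset V) (hU : ramseyNumber t m ≤ U.card) :
    ∃ C ⊆ U, G.IsNClique t C := by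
  rcases (isRamsey_ramseyNumber t m).exists_subset G U hU with h | ⟨I, -, hI⟩
  · exact h
  · have := hI.1.card_le_indepNum
    rw [hI.2] at this
    omega

/-! ### The inverse Ramsey function -/

theorem indepNum_comap_le [Finite V] [Finite W] (G : SimpleGraph W) (e : V ↪ W) :
    (G.comap e).indepNum ≤ G.indepNum := by
  obtain ⟨I, hI⟩ := (G.comap e).exists_isNIndepSet_indepNum
  rw [← hI.2, ← Finset.card_map e]
  refine SimpleGraph.IsIndepSet.card_le_indepNum ?_
  intro x hx y hy hxy
  obtain ⟨i, hi, rfl⟩ := Finset.mem_map.1 hx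
  obtain ⟨j, hj, rfl⟩ := Finset.mem_map.1 hy
  exact hI.1 hi hj (fun h => hxy (by rw [h]))

theorem Q_le_indepNum [Fintype V] {G : SimpleGraph V} {t n : ℕ} (hG : G.CliqueFree t)
    (hn : n ≤ Fintype.card V) : Q t n ≤ G.indepNum := by
  obtain ⟨e⟩ : Nonempty (Fin n ↪ V) := Function.Embedding.nonempty_of_card_le (by simpa)
  refine le_trans (Nat.sInf_le ⟨G.comap e, ?_, rfl⟩) (indepNum_comap_le G e)
  exact hG.comap (SimpleGraph.Embedding.comap e G).isContained

theorem exists_indepNum_eq_Q {t : ℕ} (ht : 2 ≤ t) (n : ℕ) :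
    ∃ G : SimpleGraph (Fin n), G.CliqueFree t ∧ G.indepNum = Q t n :=
  Nat.sInf_mem (s := {a : ℕ | ∃ G : SimpleGraph (Fin n), G.CliqueFree t ∧ G.indepNum = a})
    ⟨_, ⊥, SimpleGraph.cliqueFree_bot ht, rfl⟩

theorem Q_mono {t a b : ℕ} (ht : 2 ≤ t) (hab : a ≤ b) : Q t a ≤ Q t b := by
  obtain ⟨G, hG, hG'⟩ := exists_indepNum_eq_Q ht b
  exact hG' ▸ Q_le_indepNum hG (by simpa)

/-- With `lt_ramseyNumber_Q_succ` this is the inverse relation `R(t, Q) ≤ n < R(t, Q + 1)`. -/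
theorem ramseyNumber_Q_le (t n : ℕ) : ramseyNumber t (Q t n) ≤ n := by
  refine IsRamsey.ramseyNumber_le fun G => ?_
  by_cases hG : G.CliqueFree t
  · right
    have h := Q_le_indepNum hG (n := n) (by simp)
    obtain ⟨I, hI⟩ := G.exists_isNIndepSet_indepNum
    rw [← hI.2] at h
    obtain ⟨J, hJ, hJ'⟩ := Finset.exists_subset_card_eq h
    exact fun hf => hf J ⟨hI.1.mono (by exact_mod_cast hJ), hJ'⟩
  · exact Or.inl hG

theorem lt_ramseyNumber_Q_succ {t : ℕ} (ht : 2 ≤ t) (n : ℕ) :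
    n < ramseyNumber t (Q t n + 1) := by
  by_contra! h
  obtain ⟨G, hG, hG'⟩ := exists_indepNum_eq_Q ht n
  obtain ⟨C, -, hC⟩ := exists_isNClique_of_indepNum_lt (G := G) (t := t) (m := Q t n + 1)
    (by omega) Finset.univ (by simpa)
  exact hG C hC

theorem lt_Q_succ_pow {t : ℕ} (ht : 2 ≤ t) (n : ℕ) : n < (Q t n + 1) ^ t :=
  (lt_ramseyNumber_Q_succ ht n).trans_le (ramseyNumber_le_pow _ _)

/-- The inverse Ramsey function is subadditive: take disjoint copies. -/
theorem Q_le_mul_indepNum [Fintype V] {G : SimpleGraph V} {t n q : ℕ}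
    (hG : G.CliqueFree t) (hn : n ≤ q * Fintype.card V) : Q t n ≤ q * G.indepNum := by
  classical
  let H : SimpleGraph (V × Fin q) :=
    { Adj := fun x y => x.2 = y.2 ∧ G.Adj x.1 y.1
      symm := ⟨fun x y h => ⟨h.1.symm, h.2.symm⟩⟩
      loopless := ⟨fun x h => G.loopless.irrefl _ h.2⟩ }
  have hH : H.CliqueFree t := by
    intro C hC
    have hinj : Set.InjOn Prod.fst (C : Set (V × Fin q)) := by
      intro x hx y hy hxy
      by_contra hne
      exact (hC.1 hx hy hne).2.ne hxy
    refine hG (C.image Prod.fst) ⟨?_, ?_⟩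
    · intro x hx y hy hxy
      obtain ⟨x, hx', rfl⟩ := Finset.mem_image.1 hx
      obtain ⟨y, hy', rfl⟩ := Finset.mem_image.1 hy
      exact (hC.1 hx' hy' (fun h => hxy (by rw [h]))).2
    · rw [Finset.card_image_of_injOn hinj, hC.2]
  refine (Q_le_indepNum hH (by simpa [mul_comm] using hn)).trans ?_
  obtain ⟨I, hI⟩ := H.exists_isNIndepSet_indepNum
  rw [← hI.2, Finset.card_eq_sum_card_fiberwise (f := Prod.snd) (t := Finset.univ) (by simp)]
  calc _ ≤ ∑ _i : Fin q, G.indepNum := ?_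
    _ = _ := by simp
  refine Finset.sum_le_sum fun i _ => ?_
  have hinj : Set.InjOn Prod.fst (I.filter (fun x => x.2 = i) : Set (V × Fin q)) := by
    intro x hx y hy hxy
    simp only [Finset.coe_filter, Set.mem_ofPred_eq] at hx hy
    exact Prod.ext hxy (hx.2.trans hy.2.symm)
  rw [← Finset.card_image_of_injOn hinj]
  refine SimpleGraph.IsIndepSet.card_le_indepNum ?_
  intro x hx y hy hxy
  obtain ⟨x, hx', rfl⟩ := Finset.mem_image.1 hx
  obtain ⟨y, hy', rfl⟩ := Finset.mem_image.1 hy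
  rw [Finset.mem_filter] at hx' hy'
  exact fun h => hI.1 hx'.1 hy'.1 (fun h => hxy (by rw [h])) ⟨hx'.2.trans hy'.2.symm, h⟩

/-- If `U` were `K_t`-free, `q` disjoint copies of it would have at least `n` vertices and
independence number at most `q α(G)`, which is below `Q t n`. -/
theorem exists_isNClique_of_indepNum_lt_mul_Q [Fintype V] {G : SimpleGraph V} {t n q : ℕ}
    {x : ℝ} (hx : q * x ≤ 1) (hG : (G.indepNum : ℝ) < x * Q t n) (U : Finset V)
    (hU : n ≤ q * U.card) : ∃ C ⊆ U, G.IsNClique t C := by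
  by_contra! h
  have hfree : (G.comap (Function.Embedding.subtype (· ∈ U))).CliqueFree t := by
    intro C hC
    refine h (C.map (.subtype _)) ?_ ⟨?_, by simpa using hC.2⟩
    · intro x hx
      obtain ⟨i, -, rfl⟩ := Finset.mem_map.1 hx
      exact i.2
    · intro x hx y hy hxy
      obtain ⟨i, hi, rfl⟩ := Finset.mem_map.1 hx
      obtain ⟨j, hj, rfl⟩ := Finset.mem_map.1 hy
      exact hC.1 hi hj (fun h => hxy (by rw [h]))
  have h1 := Q_le_mul_indepNum hfree (n := n) (q := q) (by simpa)
  have h2 : Q t n ≤ q * G.indepNum := h1.trans (Nat.mul_le_mul_left _ (indepNum_comap_le _ _))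
  have h3 : (Q t n : ℝ) ≤ q * G.indepNum := by exact_mod_cast h2
  have h4 : (0 : ℝ) ≤ Q t n := Nat.cast_nonneg _
  rcases Nat.eq_zero_or_pos q with rfl | hq
  · have h5 : (Q t n : ℝ) = 0 := le_antisymm (by simpa using h3) h4
    rw [h5, mul_zero] at hG
    exact absurd hG (not_lt.2 (Nat.cast_nonneg _))
  · have h5 : (0 : ℝ) < q := by exact_mod_cast hq
    nlinarith

/-! ### Consequences of the gap conjecture for `Q` -/

theorem tendsto_Q {t : ℕ} (ht : 2 ≤ t) : Tendsto (Q t) atTop atTop := by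
  refine tendsto_atTop.2 fun b => ?_
  filter_upwards [eventually_ge_atTop (b ^ t)] with n hn
  have h := hn.trans_lt (lt_Q_succ_pow ht n)
  have := lt_of_pow_lt_pow_left₀ t (Nat.zero_le _) h
  omega

/-- At `m = Q t n` the gap gives `R(t - 1, m) ≤ n / m^ϑ`, and `m` is at least `n^(1/(2t))`. -/
theorem eventually_ramseyNumber_Q_le_rpow {t : ℕ} (ht : 2 ≤ t) (hC : RamseyGapConjecture t) :
    ∃ ε : ℝ, 0 < ε ∧ ∀ᶠ n : ℕ in atTop,
      (ramseyNumber (t - 1) (Q t n) : ℝ) ≤ (n : ℝ) ^ (1 - ε) := by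
  obtain ⟨ϑ, hϑ, N, -, h⟩ := hC
  have ht' : (0 : ℝ) < t := by exact_mod_cast (by omega : 0 < t)
  refine ⟨ϑ / (2 * t), by positivity, ?_⟩
  filter_upwards [(tendsto_Q ht).eventually_gt_atTop N, (tendsto_Q ht).eventually_ge_atTop 2,
    eventually_gt_atTop 0] with n h1 h2 h3
  have hn0 : (0 : ℝ) < n := by exact_mod_cast h3
  have hm0 : (0 : ℝ) < Q t n := by exact_mod_cast (by omega : 0 < Q t n)
  have h4 : (n : ℝ) ≤ (Q t n : ℝ) ^ (2 * t) := by
    have : n ≤ (Q t n) ^ (2 * t) := by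
      rw [pow_mul]
      exact (lt_Q_succ_pow ht n).le.trans (Nat.pow_le_pow_left (by nlinarith) _)
    exact_mod_cast this
  have h5 : (n : ℝ) ^ (ϑ / (2 * t)) ≤ (Q t n : ℝ) ^ ϑ := by
    calc (n : ℝ) ^ (ϑ / (2 * t)) ≤ ((Q t n : ℝ) ^ (2 * t)) ^ (ϑ / (2 * t)) := by gcongr
      _ = (Q t n : ℝ) ^ ϑ := by
        rw [← Real.rpow_natCast, ← Real.rpow_mul hm0.le]
        congr 1
        push_cast
        field_simp
  have h6 : (ramseyNumber t (Q t n) : ℝ) ≤ n := by exact_mod_cast ramseyNumber_Q_le t n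
  calc (ramseyNumber (t - 1) (Q t n) : ℝ) ≤ ramseyNumber t (Q t n) / (Q t n : ℝ) ^ ϑ := h _ h1
    _ ≤ n / (n : ℝ) ^ (ϑ / (2 * t)) := by gcongr
    _ = (n : ℝ) ^ (1 - ϑ / (2 * t)) := by rw [Real.rpow_sub hn0, Real.rpow_one]

/-- If both values equalled `m`, then `n < R(t, m + 1) ≤ R(t - 1, m + 1) + R(t, m)`. The gap bounds
the first summand by a quarter of `R(t, m + 1)`, and the second is at most `n/2 + 1`: a
contradiction. -/
theorem eventually_Q_div_lt {t k : ℕ} (ht : 2 ≤ t) (hk : 2 ≤ k) (hC : RamseyGapConjecture t) :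
    ∀ᶠ n : ℕ in atTop, Q t (n / k + 1) < Q t n := by
  obtain ⟨ϑ, hϑ, N, -, h⟩ := hC
  have hlim : ∀ᶠ m : ℕ in atTop, (4 : ℝ) ≤ (m : ℝ) ^ ϑ :=
    ((tendsto_rpow_atTop hϑ).comp tendsto_natCast_atTop_atTop).eventually_ge_atTop 4
  have hQ : Tendsto (fun n => Q t n + 1) atTop atTop :=
    tendsto_atTop_mono (fun n => Nat.le_succ _) (tendsto_Q ht)
  filter_upwards [hQ.eventually_gt_atTop N, hQ.eventually hlim, eventually_ge_atTop 4] with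
    n h1 h2 h3
  have hdiv : n / k ≤ n / 2 := Nat.div_le_div_left hk (by norm_num)
  by_contra! hle
  have heq : Q t n = Q t (n / k + 1) := le_antisymm hle (Q_mono ht (by omega))
  have h4 : ramseyNumber t (Q t n) ≤ n / k + 1 := heq ▸ ramseyNumber_Q_le t (n / k + 1)
  have h5 := lt_ramseyNumber_Q_succ ht n
  have h6 := ramseyNumber_succ_le (t := t - 1) (by omega) (Q t n)
  rw [Nat.sub_add_cancel (by omega : 1 ≤ t)] at h6
  have h7 := h _ h1
  have h8 : (ramseyNumber t (Q t n + 1) : ℝ) / ((Q t n + 1 : ℕ) : ℝ) ^ ϑ ≤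
      ramseyNumber t (Q t n + 1) / 4 := by gcongr
  have h9 : 4 * ramseyNumber (t - 1) (Q t n + 1) ≤ ramseyNumber t (Q t n + 1) := by
    have : (4 : ℝ) * ramseyNumber (t - 1) (Q t n + 1) ≤ ramseyNumber t (Q t n + 1) := by linarith
    exact_mod_cast this
  omega

/-! ### Dependent random choice and blowing up cliques -/

open Classical in
/-- Dependent random choice for a dense relation: a large set of vertices all of whose `r`-subsets
have many common neighbours. -/
theorem exists_subset_forall_le_card_common {Y : Type*} [Fintype V] [Fintype Y] [Nonempty V]
    [Nonempty Y] (S : V → Y → Prop) (r q : ℕ) {p δ : ℝ}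
    (hp : 0 ≤ p) (hδ : 0 ≤ δ)
    (hS : p * (Fintype.card V * Fintype.card Y) ≤
      ∑ x, ((Finset.univ.filter (S x)).card : ℝ))
    (hbad : (Fintype.card V : ℝ) ^ (r + 1) * δ ^ (q + 1) ≤ 1)
    (hpos : 1 < (Fintype.card V : ℝ) * p ^ (q + 1)) :
    ∃ U : Finset V, (Fintype.card V : ℝ) * p ^ (q + 1) - 1 ≤ U.card ∧
      ∀ X ⊆ U, X.card = r →
        δ * Fintype.card Y ≤ (Finset.univ.filter (fun y => ∀ x ∈ X, S x y)).card := by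
  classical
  set N : ℝ := (Fintype.card V : ℝ) with hN
  set M : ℝ := (Fintype.card Y : ℝ) with hM
  have hN0 : 0 < N := by
    rw [hN]; exact_mod_cast Fintype.card_pos
  have hM0 : 0 < M := by
    rw [hM]; exact_mod_cast Fintype.card_pos
  -- `f` samples `q + 1` elements of `Y` with repetition, and `U f` collects the vertices related to
  -- all of them.
  let U : (Fin (q + 1) → Y) → Finset V := fun f => Finset.univ.filter (fun x => ∀ i, S x (f i))
  let P : Finset V → Y → Prop := fun X y => ∀ x ∈ X, S x y
  let c : Finset V → ℝ := fun X => (Finset.univ.filter (P X)).card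
  let 𝓑 : Finset (Finset V) :=
    (Finset.univ.powersetCard r).filter (fun X => c X < δ * M)
  let bad : (Fin (q + 1) → Y) → Finset (Finset V) := fun f => 𝓑.filter (fun X => X ⊆ U f)
  have hcard : ∀ P : Y → Prop, ((Finset.univ.filter
      (fun f : Fin (q + 1) → Y => ∀ i, P (f i))).card : ℝ) =
      ((Finset.univ.filter P).card : ℝ) ^ (q + 1) := by
    intro P
    have : Finset.univ.filter (fun f : Fin (q + 1) → Y => ∀ i, P (f i)) =
        Fintype.piFinset (fun _ => Finset.univ.filter P) := by
      ext f; simp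
    rw [this, Fintype.card_piFinset_const]
    push_cast
    rfl
  have hsumU : ∑ f, ((U f).card : ℝ) =
      ∑ x, ((Finset.univ.filter (S x)).card : ℝ) ^ (q + 1) := by
    simp_rw [← hcard, U, Finset.card_filter]
    push_cast
    rw [Finset.sum_comm]
  have hsumB : ∑ f, ((bad f).card : ℝ) = ∑ X ∈ 𝓑, c X ^ (q + 1) := by
    rw [show ∑ X ∈ 𝓑, c X ^ (q + 1) = ∑ X ∈ 𝓑, ((Finset.univ.filter
      (fun f : Fin (q + 1) → Y => ∀ i, P X (f i))).card : ℝ) from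
      Finset.sum_congr rfl fun X _ => by simp only [c]; convert (hcard (P X)).symm]
    simp_rw [bad, Finset.card_filter]
    push_cast
    rw [Finset.sum_comm]
    refine Finset.sum_congr rfl fun X _ => Finset.sum_congr rfl fun f _ => ?_
    congr 1
    simp only [P, U, Finset.subset_iff, Finset.mem_filter, Finset.mem_univ, true_and, eq_iff_iff]
    exact ⟨fun h i x hx => h hx i, fun h x hx i => h i x hx⟩
  -- Convexity (the power mean inequality) bounds the average size of `U f` below.
  have hlow : M ^ (q + 1) * (N * p ^ (q + 1)) ≤ ∑ f, ((U f).card : ℝ) := by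
    rw [hsumU]
    refine le_trans ?_ (pow_sum_div_card_le_sum_pow (fun i _ => Nat.cast_nonneg _) q)
    rw [Finset.card_univ, ← hN, le_div_iff₀ (by positivity)]
    calc M ^ (q + 1) * (N * p ^ (q + 1)) * N ^ q = (p * (N * M)) ^ (q + 1) := by ring
      _ ≤ _ := by gcongr
  have hup : N * ∑ f, ((bad f).card : ℝ) ≤ M ^ (q + 1) := by
    rw [hsumB]
    have h1 : ∑ X ∈ 𝓑, c X ^ (q + 1) ≤ N ^ r * (δ * M) ^ (q + 1) := by
      calc ∑ X ∈ 𝓑, c X ^ (q + 1) ≤ ∑ X ∈ 𝓑, (δ * M) ^ (q + 1) := by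
            refine Finset.sum_le_sum fun X hX => ?_
            have := (Finset.mem_filter.1 hX).2
            exact pow_le_pow_left₀ (Nat.cast_nonneg _) this.le _
        _ = 𝓑.card * (δ * M) ^ (q + 1) := by simp
        _ ≤ _ := by
            gcongr
            have : 𝓑.card ≤ (Fintype.card V) ^ r := by
              refine (Finset.card_filter_le _ _).trans ?_
              rw [Finset.card_powersetCard, Finset.card_univ]
              exact Nat.choose_le_pow _ _
            rw [hN]
            exact_mod_cast this
    calc N * ∑ X ∈ 𝓑, c X ^ (q + 1) ≤ N * (N ^ r * (δ * M) ^ (q + 1)) := by gcongr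
      _ = N ^ (r + 1) * δ ^ (q + 1) * M ^ (q + 1) := by ring
      _ ≤ 1 * M ^ (q + 1) := by gcongr
      _ = _ := one_mul _
  have hsum : ∑ _f : Fin (q + 1) → Y, (N * p ^ (q + 1) - 1) ≤
      ∑ f, ((U f).card - N * (bad f).card) := by
    have hconst : ∑ _f : Fin (q + 1) → Y, (N * p ^ (q + 1) - 1) =
        M ^ (q + 1) * (N * p ^ (q + 1) - 1) := by simp [hM]; ring
    rw [hconst, Finset.sum_sub_distrib, ← Finset.mul_sum]
    linarith
  obtain ⟨f, -, hf⟩ := Finset.exists_le_of_sum_le Finset.univ_nonempty hsum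
  -- Bad sets carry weight `N ≥ |U f|`, so even one would make the difference nonpositive; no
  -- deletion step is needed.
  have hbadf : (bad f).card = 0 := by
    by_contra h
    have h1 : (1 : ℝ) ≤ (bad f).card := by exact_mod_cast Nat.one_le_iff_ne_zero.2 h
    have h2 : ((U f).card : ℝ) ≤ N := by
      rw [hN]; exact_mod_cast Finset.card_le_univ _
    nlinarith
  refine ⟨U f, by simpa [hbadf] using hf, fun X hX hr => ?_⟩
  by_contra! hlt
  have : X ∈ bad f := by
    simp only [bad, 𝓑, Finset.mem_filter, Finset.mem_powersetCard, Finset.subset_univ, true_and]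
    refine ⟨⟨hr, lt_of_eq_of_lt ?_ hlt⟩, hX⟩
    simp only [c, P]
  rw [Finset.card_eq_zero] at hbadf
  simp [hbadf] at this

/-- `v` lists pairwise adjacent vertices. -/
def IsCliqueTuple (G : SimpleGraph V) {j : ℕ} (v : Fin j → V) : Prop :=
  ∀ a b, a ≠ b → G.Adj (v a) (v b)

theorem isCliqueTuple_cons {G : SimpleGraph V} {j : ℕ} {x : V} {v : Fin j → V} :
    IsCliqueTuple G (Fin.cons x v : Fin (j + 1) → V) ↔
      IsCliqueTuple G v ∧ ∀ a, G.Adj x (v a) := by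
  constructor
  · intro h
    refine ⟨fun a b hab => ?_, fun a => ?_⟩
    · simpa using h a.succ b.succ (by simpa using hab)
    · simpa using h 0 a.succ (Fin.succ_ne_zero a).symm
  · rintro ⟨h1, h2⟩ a b hab
    induction a using Fin.cases with
    | zero =>
      induction b using Fin.cases with
      | zero => exact absurd rfl hab
      | succ b => simpa using h2 b
    | succ a =>
      induction b using Fin.cases with
      | zero => simpa using (h2 a).symm
      | succ b => simpa using h1 a b (fun h => hab (by rw [h]))

open Classical in
theorem card_eq_sum_card_cons [Fintype V] {j : ℕ} (S : Finset (Fin (j + 1) → V)) :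
    S.card = ∑ x, (Finset.univ.filter
      (fun y : Fin j → V => (Fin.cons x y : Fin (j + 1) → V) ∈ S)).card := by
  rw [Finset.card_eq_sum_card_fiberwise (f := fun v => v 0) (t := Finset.univ) (by simp)]
  refine Finset.sum_congr rfl fun x _ => ?_
  refine Finset.card_bij' (fun v _ => Fin.tail v) (fun y _ => Fin.cons x y) ?_ ?_ ?_ ?_
  · intro v hv
    obtain ⟨h1, rfl⟩ := Finset.mem_filter.1 hv
    simpa using h1
  · intro y hy
    simpa using hy
  · intro v hv
    obtain ⟨h1, rfl⟩ := Finset.mem_filter.1 hv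
    simp
  · intro y hy
    simp

/-- The union of completely joined cliques is a clique. -/
theorem isNClique_union [DecidableEq V] {G : SimpleGraph V} {a b : ℕ} {X T : Finset V}
    (hX : G.IsNClique a X) (hT : G.IsNClique b T) (h : ∀ x ∈ X, ∀ y ∈ T, G.Adj x y) :
    G.IsNClique (a + b) (X ∪ T) := by
  have hdisj : Disjoint X T := by
    rw [Finset.disjoint_left]
    exact fun x hx hx' => (h x hx x hx').ne rfl
  refine ⟨?_, by rw [Finset.card_union_of_disjoint hdisj, hX.2, hT.2]⟩
  intro x hx y hy hxy
  simp only [Finset.coe_union, Set.mem_union, Finset.mem_coe] at hx hy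
  rcases hx with hx | hx <;> rcases hy with hy | hy
  · exact hX.1 hx hy hxy
  · exact h x hx y hy
  · exact (h y hy x hx).symm
  · exact hT.1 hx hy hxy

theorem eventually_rpow_le_rpow_sub_one {ε : ℝ} (hε : 0 < ε) (hε1 : ε ≤ 1) :
    ∀ᶠ N : ℕ in atTop, (N : ℝ) ^ (1 - ε) ≤ (N : ℝ) ^ (1 - ε / 2) - 1 := by
  have h := ((tendsto_rpow_atTop (half_pos hε)).comp
    tendsto_natCast_atTop_atTop).eventually_ge_atTop 2
  filter_upwards [h, eventually_ge_atTop 1] with N h1 h2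
  have hN : (1 : ℝ) ≤ N := by exact_mod_cast h2
  have h3 : (N : ℝ) ^ (1 - ε / 2) = (N : ℝ) ^ (1 - ε) * (N : ℝ) ^ (ε / 2) := by
    rw [← Real.rpow_add (by linarith)]
    ring_nf
  have h4 : 1 ≤ (N : ℝ) ^ (1 - ε) := Real.one_le_rpow hN (by linarith)
  simp only [Function.comp_apply] at h1
  rw [h3]
  nlinarith

/-- If all vertex sets of almost full exponent contain `r`-cliques, then so many `j`-cliques that
their density is almost constant yield a clique on `j * r` vertices. -/
theorem exists_isNClique_mul_of_many_cliqueTuples {ε : ℝ} (hε : 0 < ε) (hε1 : ε ≤ 1) {r : ℕ}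
    (hr : 0 < r) (j : ℕ) :
    ∃ δ : ℝ, 0 < δ ∧ ∀ᶠ N : ℕ in atTop, ∀ {V : Type} [Fintype V] (G : SimpleGraph V),
      Fintype.card V = N →
      (∀ U : Finset V, (N : ℝ) ^ (1 - ε) ≤ U.card → ∃ C ⊆ U, G.IsNClique r C) →
      ∀ S : Finset (Fin j → V), (∀ v ∈ S, IsCliqueTuple G v) →
        (N : ℝ) ^ ((j : ℝ) - δ) ≤ S.card →
        ∃ T : Finset V, G.IsNClique (j * r) T ∧ ∀ x ∈ T, ∃ v ∈ S, ∃ a, v a = x := by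
  classical
  induction j with
  | zero =>
    refine ⟨1, one_pos, ?_⟩
    filter_upwards with N V _ G _ _ S _ _
    exact ⟨∅, by simp, by simp⟩
  | succ j ih =>
    obtain ⟨δ', hδ', ih⟩ := ih
    -- Large enough that `N^(r+1) · N^(-δ'(q+1)) ≤ 1`, so bad `r`-sets can be avoided.
    obtain ⟨q, hq⟩ := exists_nat_ge ((r + 1) / δ')
    have hq' : (r + 1 : ℝ) ≤ δ' * (q + 1) := by
      rw [div_le_iff₀ hδ'] at hq
      nlinarith
    -- Makes `p^(q+1) = N^(-ε/2)`, so that `U` retains `N^(1-ε/2) - 1 ≥ N^(1-ε)` vertices and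
    -- contains an `r`-clique.
    refine ⟨ε / (2 * (q + 1)), by positivity, ?_⟩
    filter_upwards [ih, eventually_rpow_le_rpow_sub_one hε hε1, eventually_ge_atTop 1] with
      N ih hN hN1 V _ G hV hP S hS hcard
    have hN1' : (1 : ℝ) ≤ N := by exact_mod_cast hN1
    have hN0 : (0 : ℝ) < N := by linarith
    have : Nonempty V := Fintype.card_pos_iff.1 (by omega)
    have hY : (Fintype.card (Fin j → V) : ℝ) = (N : ℝ) ^ j := by simp [hV]
    have hpow : (N : ℝ) * ((N : ℝ) ^ (-(ε / (2 * (q + 1))))) ^ (q + 1) =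
        (N : ℝ) ^ (1 - ε / 2) := by
      rw [← Real.rpow_natCast, ← Real.rpow_mul hN0.le]
      nth_rewrite 1 [← Real.rpow_one (N : ℝ)]
      rw [← Real.rpow_add hN0]
      congr 1
      push_cast
      field_simp
      ring
    obtain ⟨U, hU, hU'⟩ := exists_subset_forall_le_card_common
      (fun (x : V) (y : Fin j → V) => (Fin.cons x y : Fin (j + 1) → V) ∈ S) r q
      (p := (N : ℝ) ^ (-(ε / (2 * (q + 1))))) (δ := (N : ℝ) ^ (-δ'))
      (by positivity) (by positivity) (by
        rw [hY, hV]
        have h1 := card_eq_sum_card_cons S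
        have h2 : (S.card : ℝ) = ∑ x, ((Finset.univ.filter
          (fun y : Fin j → V => (Fin.cons x y : Fin (j + 1) → V) ∈ S)).card : ℝ) := by
          exact_mod_cast h1
        refine le_trans (le_of_eq ?_) (hcard.trans (le_of_eq (h2.trans ?_)))
        · rw [← pow_succ', ← Real.rpow_natCast, ← Real.rpow_add hN0]
          congr 1
          ring
        · exact Finset.sum_congr rfl fun x _ => by congr) (by
        rw [hV, ← Real.rpow_natCast, ← Real.rpow_natCast, ← Real.rpow_mul hN0.le,
          ← Real.rpow_add hN0]
        refine Real.rpow_le_one_of_one_le_of_nonpos hN1' ?_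
        push_cast
        linarith) (by
        rw [hV, hpow]
        have : 0 < (N : ℝ) ^ (1 - ε) := by positivity
        linarith)
    rw [hV, hpow] at hU
    obtain ⟨X, hXU, hX⟩ := hP U (hN.trans hU)
    obtain ⟨x₀, hx₀⟩ : X.Nonempty := Finset.card_pos.1 (hX.2 ▸ hr)
    set S' := Finset.univ.filter
      (fun y : Fin j → V => ∀ x ∈ X, (Fin.cons x y : Fin (j + 1) → V) ∈ S) with hS'
    have hcard' : (N : ℝ) ^ ((j : ℝ) - δ') ≤ S'.card := by
      refine le_trans (le_of_eq ?_) (le_of_le_of_eq (hU' X hXU hX.2) ?_)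
      · rw [hY, ← Real.rpow_natCast, ← Real.rpow_add hN0]
        congr 1
        ring
      · rw [hS']
        congr
    have hmem : ∀ y ∈ S', ∀ x ∈ X, (Fin.cons x y : Fin (j + 1) → V) ∈ S := fun y hy =>
      (Finset.mem_filter.1 hy).2
    obtain ⟨T, hT, hT'⟩ := ih G hV hP S'
      (fun v hv => (isCliqueTuple_cons.1 (hS _ (hmem v hv x₀ hx₀))).1) hcard'
    refine ⟨X ∪ T, ?_, ?_⟩
    · rw [add_mul, one_mul, add_comm]
      refine isNClique_union hX hT fun x hx y hy => ?_
      -- Each vertex of `T` is an entry of a tuple in `S'`, and every vertex of `X` extends that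
      -- tuple to a clique; hence `X` and `T` are completely joined.
      obtain ⟨v, hv, a, rfl⟩ := hT' y hy
      exact (isCliqueTuple_cons.1 (hS _ (hmem v hv x hx))).2 a
    · intro x hx
      rcases Finset.mem_union.1 hx with hx | hx
      · obtain ⟨y, hy⟩ : S'.Nonempty := by
          rw [← Finset.card_pos]
          have : (0 : ℝ) < S'.card := lt_of_lt_of_le (by positivity) hcard'
          exact_mod_cast this
        exact ⟨_, hmem y hy x hx, 0, by simp⟩
      · obtain ⟨v, hv, a, rfl⟩ := hT' x hx
        exact ⟨_, hmem v hv x₀ hx₀, a.succ, by simp⟩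

/-! ### Degrees, clique counts and stability -/

open Classical in
/-- A dense graph has a large subset in which all degrees are almost as large as the density
allows. -/
theorem exists_subset_forall_le_degree [Fintype V] (G : SimpleGraph V) {a η : ℝ} (ha : 0 ≤ a)
    (ha1 : a ≤ 1)
    (hG : (a + η) * (Fintype.card V : ℝ) ^ 2 ≤ ∑ x, ((Finset.univ.filter (G.Adj x)).card : ℝ)) :
    ∃ W : Finset V, η * (Fintype.card V : ℝ) ^ 2 ≤ (W.card : ℝ) ^ 2 ∧
      ∀ x ∈ W, a * W.card - 1 / 2 ≤ ((W.filter (G.Adj x)).card : ℝ) := by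
  let E : Finset V → ℝ := fun W => ∑ x ∈ W, ((W.filter (G.Adj x)).card : ℝ)
  -- A maximiser of `E W - a |W|²`, where `E` counts ordered adjacent pairs: comparison with the
  -- whole vertex set bounds `|W|`, comparison with `W.erase x` bounds the degree of `x`.
  obtain ⟨W, -, hW⟩ := Finset.exists_max_image (Finset.univ : Finset (Finset V))
    (fun W => E W - a * (W.card : ℝ) ^ 2) ⟨∅, Finset.mem_univ _⟩
  refine ⟨W, ?_, fun x hx => ?_⟩
  · have h1 := hW Finset.univ (Finset.mem_univ _)
    have h2 : E W ≤ (W.card : ℝ) ^ 2 := by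
      calc E W ≤ ∑ x ∈ W, (W.card : ℝ) :=
            Finset.sum_le_sum fun x _ => by exact_mod_cast Finset.card_filter_le _ _
        _ = _ := by simp [sq]
    simp only [E, Finset.card_univ] at h1 h2
    have h3 : 0 ≤ a * (W.card : ℝ) ^ 2 := by positivity
    nlinarith
  · have h1 := hW (W.erase x) (Finset.mem_univ _)
    have hc : ((W.erase x).card : ℝ) = W.card - 1 := by
      rw [Finset.card_erase_of_mem hx, Nat.cast_sub (Finset.card_pos.2 ⟨x, hx⟩), Nat.cast_one]
    have hE : E W = E (W.erase x) + 2 * ((W.filter (G.Adj x)).card : ℝ) := by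
      have hdeg : ((W.filter (G.Adj x)).card : ℝ) =
          ∑ y ∈ W.erase x, if G.Adj y x then (1 : ℝ) else 0 := by
        rw [Finset.card_filter, ← Finset.add_sum_erase _ _ hx]
        simp [G.adj_comm]
      have hy : ∀ y ∈ W.erase x, ((W.filter (G.Adj y)).card : ℝ) =
          (if G.Adj y x then (1 : ℝ) else 0) + (((W.erase x).filter (G.Adj y)).card : ℝ) := by
        intro y _
        rw [Finset.card_filter, Finset.card_filter, ← Finset.add_sum_erase _ _ hx]
        push_cast
        rfl
      simp only [E]
      rw [← Finset.add_sum_erase _ _ hx, Finset.sum_congr rfl hy, Finset.sum_add_distrib, ← hdeg]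
      ring
    simp only [hc, hE] at h1
    nlinarith

open Classical in
theorem card_sub_mul_le_card_common {ι : Type*} (G : SimpleGraph V) (B : Finset V)
    (s : Finset ι) (v : ι → V) {D : ℝ}
    (h : ∀ a ∈ s, ((B.filter (fun x => ¬ G.Adj (v a) x)).card : ℝ) ≤ D) :
    (B.card : ℝ) - s.card * D ≤ (B.filter (fun x => ∀ a ∈ s, G.Adj (v a) x)).card := by
  have h1 := Finset.card_filter_add_card_filter_not (s := B)
    (p := fun x => ∀ a ∈ s, G.Adj (v a) x)
  have h2 : (B.filter (fun x => ¬ ∀ a ∈ s, G.Adj (v a) x)).card ≤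
      ∑ a ∈ s, (B.filter (fun x => ¬ G.Adj (v a) x)).card := by
    refine le_trans (Finset.card_le_card ?_) Finset.card_biUnion_le
    intro x hx
    simp only [Finset.mem_filter, not_forall, Finset.mem_biUnion] at hx ⊢
    obtain ⟨hx, a, ha, hax⟩ := hx
    exact ⟨a, ha, hx, hax⟩
  have h3 : (∑ a ∈ s, ((B.filter (fun x => ¬ G.Adj (v a) x)).card : ℝ)) ≤ s.card * D := by
    simpa using Finset.sum_le_sum h
  have h4 : ((B.filter (fun x => ¬ ∀ a ∈ s, G.Adj (v a) x)).card : ℝ) ≤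
      ∑ a ∈ s, ((B.filter (fun x => ¬ G.Adj (v a) x)).card : ℝ) := by exact_mod_cast h2
  have h5 : ((B.filter (fun x => ∀ a ∈ s, G.Adj (v a) x)).card : ℝ) +
      (B.filter (fun x => ¬ ∀ a ∈ s, G.Adj (v a) x)).card = B.card := by exact_mod_cast h1
  linarith

open Classical in
/-- The ordered cliques of size `j`. -/
noncomputable def cliqueTuples [Fintype V] (G : SimpleGraph V) (j : ℕ) : Finset (Fin j → V) :=
  Finset.univ.filter (IsCliqueTuple G)

theorem mem_cliqueTuples [Fintype V] {G : SimpleGraph V} {j : ℕ} {v : Fin j → V} :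
    v ∈ cliqueTuples G j ↔ IsCliqueTuple G v := by
  simp [cliqueTuples]

open Classical in
theorem card_cliqueTuples_succ [Fintype V] (G : SimpleGraph V) (j : ℕ) :
    (cliqueTuples G (j + 1)).card =
      ∑ v ∈ cliqueTuples G j, (Finset.univ.filter (fun x => ∀ a, G.Adj (v a) x)).card := by
  rw [card_eq_sum_card_cons]
  simp_rw [Finset.card_filter, mem_cliqueTuples, isCliqueTuple_cons]
  rw [Finset.sum_comm, cliqueTuples, Finset.sum_filter]
  refine Finset.sum_congr rfl fun v _ => ?_
  split_ifs with hv
  · simp [hv, G.adj_comm]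
  · simp [hv]

open Classical in
-- Greedy extension: an `i`-clique has at least `N - i D` common neighbours.
theorem pow_le_card_cliqueTuples [Fintype V] (G : SimpleGraph V) {d D : ℝ} (hd : 0 ≤ d)
    (hD : ∀ x, ((Finset.univ.filter (fun y => ¬ G.Adj x y)).card : ℝ) ≤ D) (j : ℕ)
    (hj : ∀ i < j, d ≤ Fintype.card V - i * D) :
    d ^ j ≤ (cliqueTuples G j).card := by
  induction j with
  | zero =>
    have : (cliqueTuples G 0).Nonempty := ⟨Fin.elim0, mem_cliqueTuples.2 fun a => a.elim0⟩
    simpa using Finset.card_pos.2 this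
  | succ j ih =>
    have ih := ih fun i hi => hj i (by omega)
    rw [card_cliqueTuples_succ]
    push_cast
    calc d ^ (j + 1) = d ^ j * d := pow_succ _ _
      _ ≤ (cliqueTuples G j).card * d := by gcongr
      _ = ∑ v ∈ cliqueTuples G j, d := by simp
      _ ≤ _ := by
        refine Finset.sum_le_sum fun v _ => (hj j (by omega)).trans ?_
        simpa using card_sub_mul_le_card_common G Finset.univ Finset.univ v fun a _ => hD (v a)

open Classical in
/-- Vertices adjacent to all entries of `v` except possibly the `i`-th. -/
noncomputable def commonExcept [Fintype V] (G : SimpleGraph V) {k : ℕ} (v : Fin k → V) (i : Fin k) :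
    Finset V :=
  Finset.univ.filter (fun x => ∀ a ∈ Finset.univ.erase i, G.Adj (v a) x)

theorem mem_commonExcept [Fintype V] {G : SimpleGraph V} {k : ℕ} {v : Fin k → V} {i : Fin k}
    {x : V} : x ∈ commonExcept G v i ↔ ∀ a ≠ i, G.Adj (v a) x := by
  simp [commonExcept]

open Classical in
-- Replacing `v i` by `x` and prepending `y` gives a `(k+1)`-clique; the factor `|V|` remembers the
-- overwritten `v i`, which makes the map injective.
theorem sum_card_pairs_le [Fintype V] (G : SimpleGraph V) {k : ℕ} (i : Fin k) :
    ∑ v ∈ cliqueTuples G k, ∑ x ∈ commonExcept G v i,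
      ((commonExcept G v i).filter (G.Adj x)).card ≤
    Fintype.card V * (cliqueTuples G (k + 1)).card := by
  simp_rw [← Finset.card_sigma]
  rw [← Finset.card_univ, ← Finset.card_product]
  refine Finset.card_le_card_of_injOn
    (fun z => (z.1 i, Fin.cons z.2.2 (Function.update z.1 i z.2.1))) ?_ ?_
  · rintro ⟨v, x, y⟩ hz
    simp only [Finset.mem_coe, Finset.mem_sigma, Finset.mem_filter, mem_cliqueTuples,
      mem_commonExcept] at hz
    obtain ⟨hv, hx, hy, hxy⟩ := hz
    simp only [Finset.mem_coe, Finset.mem_product, Finset.mem_univ, true_and, mem_cliqueTuples,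
      isCliqueTuple_cons]
    refine ⟨fun a b hab => ?_, fun a => ?_⟩
    · by_cases ha : a = i
      · subst ha
        rw [Function.update_self, Function.update_of_ne hab.symm]
        exact (hx b hab.symm).symm
      · by_cases hb : b = i
        · subst hb
          rw [Function.update_self, Function.update_of_ne hab]
          exact hx a hab
        · rw [Function.update_of_ne ha, Function.update_of_ne hb]
          exact hv a b hab
    · by_cases ha : a = i
      · subst ha
        rw [Function.update_self]
        exact hxy.symm
      · rw [Function.update_of_ne ha]
        exact (hy a ha).symm
  · rintro ⟨v, x, y⟩ - ⟨v', x', y'⟩ - h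
    simp only [Prod.mk.injEq, Fin.cons_inj] at h
    obtain ⟨h1, rfl, h2⟩ := h
    have hx : x = x' := by simpa using congrFun h2 i
    have hv : v = v' := by
      funext a
      by_cases ha : a = i
      · rw [ha, h1]
      · simpa [ha] using congrFun h2 a
    rw [hx, hv]

open Classical in
/-- Stability: if all degrees are close to `(1 - 1 / k) N` and there are few `(k + 1)`-cliques, then
there are `k` sets of almost `N / k` vertices with almost all edges between them. -/
theorem exists_almost_complete_parts [Fintype V] (G : SimpleGraph V) {k : ℕ} (hk : 0 < k) {γ : ℝ}
    (hγ : 0 < γ) (hγ1 : γ ≤ 1) (hN : 0 < Fintype.card V)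
    (hdeg : ∀ x, ((Finset.univ.filter (fun y => ¬ G.Adj x y)).card : ℝ) ≤
      (1 / k + γ) * Fintype.card V)
    (hne : (cliqueTuples G k).Nonempty)
    (hfew : (k + 1) * Fintype.card V * ((cliqueTuples G (k + 1)).card : ℝ) ≤
      γ ^ 2 * Fintype.card V ^ 2 * (cliqueTuples G k).card) :
    ∃ B : Fin k → Finset V, (∀ i, (1 / k - k * γ) * Fintype.card V ≤ (B i).card) ∧
      ∀ i j, i ≠ j → ∀ x ∈ B i,
        (((B j).filter (fun y => ¬ G.Adj x y)).card : ℝ) ≤ (k + 2) * γ * Fintype.card V := by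
  set N : ℝ := (Fintype.card V : ℝ) with hNdef
  have hN0 : 0 < N := by rw [hNdef]; exact_mod_cast hN
  have hk0 : (0 : ℝ) < k := by exact_mod_cast hk
  let e : (Fin k → V) → Fin k → ℝ := fun v i =>
    ∑ x ∈ commonExcept G v i, (((commonExcept G v i).filter (G.Adj x)).card : ℝ)
  let o : (Fin k → V) → ℝ := fun v =>
    ((Finset.univ.filter (fun x => ∀ a, G.Adj (v a) x)).card : ℝ)
  have he0 : ∀ v i, 0 ≤ e v i := fun v i => Finset.sum_nonneg fun _ _ => Nat.cast_nonneg _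
  have ho0 : ∀ v, 0 ≤ o v := fun v => Nat.cast_nonneg _
  -- The factor `k + 1` in `hfew` pays for the `k` coordinates and for the common neighbours.
  -- Averaging then yields one `k`-clique for which all these counts are small.
  have hsum : ∑ v ∈ cliqueTuples G k, (∑ i, e v i + N * o v) ≤
      ∑ v ∈ cliqueTuples G k, γ ^ 2 * N ^ 2 := by
    have h1 : ∀ i, ∑ v ∈ cliqueTuples G k, e v i ≤ N * (cliqueTuples G (k + 1)).card := by
      intro i
      simp only [e, hNdef]
      exact_mod_cast sum_card_pairs_le G i
    have h2 : ∑ v ∈ cliqueTuples G k, o v = (cliqueTuples G (k + 1)).card := by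
      simp only [o]
      exact_mod_cast (card_cliqueTuples_succ G k).symm
    rw [Finset.sum_add_distrib, Finset.sum_comm, ← Finset.mul_sum, h2, Finset.sum_const,
      nsmul_eq_mul]
    have h3 : ∑ i, ∑ v ∈ cliqueTuples G k, e v i ≤
        k * (N * (cliqueTuples G (k + 1)).card) := by
      simpa using Finset.sum_le_sum fun i (_ : i ∈ (Finset.univ : Finset (Fin k))) => h1 i
    linarith
  obtain ⟨v, hv, hle⟩ := Finset.exists_le_of_sum_le hne hsum
  have heall : ∀ i, e v i ≤ γ ^ 2 * N ^ 2 := by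
    intro i
    have h1 := Finset.single_le_sum (f := e v) (fun i _ => he0 v i) (Finset.mem_univ i)
    have := mul_nonneg hN0.le (ho0 v)
    linarith
  have hov : o v ≤ γ * N := by
    have h1 : 0 ≤ ∑ i, e v i := Finset.sum_nonneg fun i _ => he0 v i
    have h2 : N * o v ≤ N * (γ ^ 2 * N) := by nlinarith
    have h3 := le_of_mul_le_mul_left h2 hN0
    have h4 : γ ^ 2 ≤ γ := by nlinarith
    nlinarith
  set A := commonExcept G v with hA
  have hAcard : ∀ i, (1 - (k - 1) * (1 / k + γ)) * N ≤ (A i).card := by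
    intro i
    have h := card_sub_mul_le_card_common G Finset.univ (Finset.univ.erase i) v
      fun a _ => hdeg (v a)
    rw [Finset.card_erase_of_mem (Finset.mem_univ i), Finset.card_univ, Finset.card_univ,
      Fintype.card_fin, Nat.cast_sub hk, ← hNdef, Nat.cast_one] at h
    refine le_trans (le_of_eq ?_) (le_of_le_of_eq h ?_)
    · ring
    · rw [hA, commonExcept]
      congr!
  have hAcard' : ∀ i, (1 / k - (k - 1) * γ) * N ≤ (A i).card := by
    intro i
    refine le_trans (le_of_eq ?_) (hAcard i)
    field_simp
    ring
  -- `A i` spans few edges, so by Markov discarding its vertices of large inner degree costs at most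
  -- `γ N` vertices.
  let B : Fin k → Finset V := fun i =>
    (A i).filter (fun x => (((A i).filter (G.Adj x)).card : ℝ) ≤ γ * N)
  have hB : ∀ i x, x ∈ B i ↔ x ∈ A i ∧ (((A i).filter (G.Adj x)).card : ℝ) ≤ γ * N :=
    fun i x => by simp [B]
  refine ⟨B, fun i => ?_, fun i j hij x hx => ?_⟩
  · have h1 := Finset.card_filter_add_card_filter_not (s := A i)
      (p := fun x => (((A i).filter (G.Adj x)).card : ℝ) ≤ γ * N)
    set C := (A i).filter (fun x => ¬ (((A i).filter (G.Adj x)).card : ℝ) ≤ γ * N) with hC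
    have h2 : (C.card : ℝ) * (γ * N) ≤ γ ^ 2 * N ^ 2 := by
      calc (C.card : ℝ) * (γ * N) = ∑ x ∈ C, γ * N := by simp
        _ ≤ ∑ x ∈ C, (((A i).filter (G.Adj x)).card : ℝ) :=
          Finset.sum_le_sum fun x hx => (not_le.1 (Finset.mem_filter.1 hx).2).le
        _ ≤ e v i := Finset.sum_le_sum_of_subset_of_nonneg (Finset.filter_subset _ _)
          fun _ _ _ => Nat.cast_nonneg _
        _ ≤ _ := heall i
    have h3 : (C.card : ℝ) ≤ γ * N := by
      refine le_of_mul_le_mul_right (h2.trans (le_of_eq ?_)) (mul_pos hγ hN0)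
      ring
    have h4 : ((B i).card : ℝ) + C.card = (A i).card := by exact_mod_cast h1
    have h5 := hAcard' i
    linarith
  · obtain ⟨hxA, hxd⟩ := (hB i x).1 hx
    have h1 := Finset.card_filter_add_card_filter_not (s := A i) (p := G.Adj x)
    -- Non-neighbours inside `A i` almost exhaust the allowance `(1/k + γ) N` of `x`, so few lie
    -- outside; and `B j ∩ A i` consists of common neighbours of all of `v`, at most `γ N` in
    -- number.
    have h2 : ((A i).filter (fun y => ¬ G.Adj x y)).card +
        (((B j).filter (fun y => ¬ G.Adj x y)).filter (fun y => y ∉ A i)).card ≤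
        (Finset.univ.filter (fun y => ¬ G.Adj x y)).card := by
      rw [← Finset.card_union_of_disjoint]
      · refine Finset.card_le_card fun y hy => ?_
        simp only [Finset.mem_union, Finset.mem_filter, Finset.mem_univ, true_and] at hy ⊢
        tauto
      · rw [Finset.disjoint_left]
        intro y hy hy'
        exact (Finset.mem_filter.1 hy').2 (Finset.mem_filter.1 hy).1
    have h3 : (((B j).filter (fun y => ¬ G.Adj x y)).filter (fun y => y ∈ A i)).card ≤
        (Finset.univ.filter (fun x => ∀ a, G.Adj (v a) x)).card := by
      refine Finset.card_le_card fun y hy => ?_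
      simp only [Finset.mem_filter, Finset.mem_univ, true_and] at hy ⊢
      intro a
      by_cases ha : a = i
      · exact mem_commonExcept.1 ((hB j y).1 hy.1.1).1 a (ha ▸ hij)
      · exact mem_commonExcept.1 hy.2 a ha
    have h4 := Finset.card_filter_add_card_filter_not
      (s := (B j).filter (fun y => ¬ G.Adj x y)) (p := fun y => y ∈ A i)
    have h1' : (((A i).filter (G.Adj x)).card : ℝ) +
      ((A i).filter (fun y => ¬ G.Adj x y)).card = (A i).card := by exact_mod_cast h1
    have h2' : (((A i).filter (fun y => ¬ G.Adj x y)).card : ℝ) +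
        (((B j).filter (fun y => ¬ G.Adj x y)).filter (fun y => y ∉ A i)).card ≤
        (Finset.univ.filter (fun y => ¬ G.Adj x y)).card := by exact_mod_cast h2
    have h3' : ((((B j).filter (fun y => ¬ G.Adj x y)).filter (fun y => y ∈ A i)).card : ℝ) ≤
        o v := by
      simp only [o]
      exact_mod_cast h3
    have h4' : ((((B j).filter (fun y => ¬ G.Adj x y)).filter (fun y => y ∈ A i)).card : ℝ) +
      (((B j).filter (fun y => ¬ G.Adj x y)).filter (fun y => y ∉ A i)).card =
      ((B j).filter (fun y => ¬ G.Adj x y)).card := by exact_mod_cast h4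
    have h5 := hAcard' i
    have h6 := hdeg x
    linarith

open Classical in
-- Greedy choice part by part: the at most `k t` vertices already chosen exclude at most `k t D`
-- vertices of the next part, leaving `L`.
theorem exists_isNClique_mul_of_almost_complete_parts {G : SimpleGraph V} {k t : ℕ} {L D : ℝ}
    (hD : 0 ≤ D) (hP : ∀ U : Finset V, L ≤ U.card → ∃ C ⊆ U, G.IsNClique t C)
    (B : Fin k → Finset V) (hB : ∀ i, L + k * t * D ≤ (B i).card)
    (hadj : ∀ i j, i ≠ j → ∀ x ∈ B i,
      (((B j).filter (fun y => ¬ G.Adj x y)).card : ℝ) ≤ D) :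
    ∃ T : Finset V, G.IsNClique (k * t) T := by
  suffices h : ∀ m ≤ k, ∃ T : Finset V, G.IsNClique (m * t) T ∧
      ∀ x ∈ T, ∃ i : Fin k, i.val < m ∧ x ∈ B i by
    obtain ⟨T, hT, -⟩ := h k le_rfl
    exact ⟨T, hT⟩
  intro m
  induction m with
  | zero => exact fun _ => ⟨∅, by simp, by simp⟩
  | succ m ih =>
    intro hm
    obtain ⟨T, hT, hT'⟩ := ih (by omega)
    let j : Fin k := ⟨m, hm⟩
    have h1 := card_sub_mul_le_card_common G (B j) T id (D := D) fun x hx => by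
      obtain ⟨i, hi, hxi⟩ := hT' x hx
      exact hadj i j (fun h => by simp [h, j] at hi) x hxi
    have h2 : (T.card : ℝ) * D ≤ k * t * D := by
      rw [hT.2]
      push_cast
      have : (m : ℝ) ≤ k := by exact_mod_cast (by omega : m ≤ k)
      gcongr
    obtain ⟨C, hC, hC'⟩ := hP _ (le_trans (by linarith [hB j]) h1)
    refine ⟨T ∪ C, ?_, fun x hx => ?_⟩
    · rw [add_mul, one_mul]
      exact isNClique_union hT hC' fun x hx y hy => (Finset.mem_filter.1 (hC hy)).2 x hx
    · rcases Finset.mem_union.1 hx with hx | hx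
      · obtain ⟨i, hi, hxi⟩ := hT' x hx
        exact ⟨i, by omega, hxi⟩
      · exact ⟨j, by simp [j], (Finset.mem_filter.1 (hC hx)).1⟩

/-! ### Cliques forced by minimum degree -/

open Classical in
/-- Degrees above the Turán threshold force large cliques in the Ramsey–Turán setting. -/
theorem exists_isNClique_of_degree_gt {ε η : ℝ} (hε : 0 < ε) (hε1 : ε ≤ 1) (hη : 0 < η)
    (hη1 : η ≤ 1) {r : ℕ} (hr : 0 < r) {k : ℕ} (hk : 0 < k) :
    ∀ᶠ N : ℕ in atTop, ∀ {V : Type} [Fintype V] (G : SimpleGraph V), Fintype.card V = N →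
      (∀ U : Finset V, (N : ℝ) ^ (1 - ε) ≤ U.card → ∃ C ⊆ U, G.IsNClique r C) →
      (∀ x, ((Finset.univ.filter (fun y => ¬ G.Adj x y)).card : ℝ) ≤ (1 / k - η) * N) →
      ∃ T : Finset V, G.IsNClique ((k + 1) * r) T := by
  obtain ⟨δ, hδ, h⟩ := exists_isNClique_mul_of_many_cliqueTuples hε hε1 hr (k + 1)
  have hlim : ∀ᶠ N : ℕ in atTop, (1 / η) ^ (k + 1) ≤ (N : ℝ) ^ δ :=
    ((tendsto_rpow_atTop hδ).comp tendsto_natCast_atTop_atTop).eventually_ge_atTop _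
  filter_upwards [h, hlim, eventually_ge_atTop 1] with N h h1 hN V _ G hV hP hdeg
  have hN0 : (0 : ℝ) < N := by exact_mod_cast hN
  have hk0 : (0 : ℝ) < k := by exact_mod_cast hk
  obtain ⟨T, hT, -⟩ := h G hV hP (cliqueTuples G (k + 1)) (fun v hv => mem_cliqueTuples.1 hv) (by
    refine le_trans ?_ (pow_le_card_cliqueTuples G (d := η * N) (by positivity) hdeg (k + 1) ?_)
    · rw [Real.rpow_sub hN0, div_le_iff₀ (by positivity), Real.rpow_natCast, mul_pow]
      have h2 : 1 ≤ η ^ (k + 1) * (N : ℝ) ^ δ := by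
        rwa [one_div, inv_pow, inv_le_iff_one_le_mul₀' (by positivity)] at h1
      have h3 : (0 : ℝ) ≤ (N : ℝ) ^ (k + 1) := by positivity
      nlinarith
    · intro i hi
      rw [hV]
      rcases Nat.eq_zero_or_pos i with rfl | hi0
      · simp only [Nat.cast_zero, zero_mul, sub_zero]
        nlinarith
      · have hi1 : (1 : ℝ) ≤ i := by exact_mod_cast hi0
        have hik : (i : ℝ) ≤ k := by exact_mod_cast (by omega : i ≤ k)
        have h2 : (i : ℝ) * (1 / k) ≤ 1 := by
          rw [mul_one_div, div_le_one hk0]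
          exact hik
        have h3 : η ≤ 1 - i * (1 / k - η) := by nlinarith
        calc η * N ≤ (1 - i * (1 / k - η)) * N := by gcongr
          _ = _ := by ring)
  exact ⟨T, hT⟩

open Classical in
/-- Degrees slightly below the Turán threshold force large cliques if all linear-sized sets contain
`t`-cliques. -/
theorem exists_isNClique_of_degree_ge {ε : ℝ} (hε : 0 < ε) (hε1 : ε ≤ 1) {r : ℕ} (hr : 0 < r)
    {k : ℕ} (hk : 0 < k) (t : ℕ) :
    ∃ γ : ℝ, 0 < γ ∧ γ ≤ 1 / 2 ∧ ∀ᶠ N : ℕ in atTop, ∀ {V : Type} [Fintype V] (G : SimpleGraph V),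
      Fintype.card V = N →
      (∀ U : Finset V, (N : ℝ) ^ (1 - ε) ≤ U.card → ∃ C ⊆ U, G.IsNClique r C) →
      (∀ U : Finset V, (N : ℝ) / (2 * k) ≤ U.card → ∃ C ⊆ U, G.IsNClique t C) →
      (∀ x, ((Finset.univ.filter (fun y => ¬ G.Adj x y)).card : ℝ) ≤ (1 / k + γ) * N) →
      (∃ T : Finset V, G.IsNClique ((k + 1) * r) T) ∨ ∃ T : Finset V, G.IsNClique (k * t) T := by
  obtain ⟨δ, hδ, h⟩ := exists_isNClique_mul_of_many_cliqueTuples hε hε1 hr (k + 1)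
  have hk1 : (1 : ℝ) ≤ k := by exact_mod_cast hk
  have hk0 : (0 : ℝ) < k := by linarith
  have ht0 : (0 : ℝ) ≤ t := Nat.cast_nonneg t
  -- Solves `1/k - kγ - k t (k + 2) γ = 1/(2k)`: after stability and the greedy losses, exactly
  -- `N/(2k)` vertices are guaranteed per part.
  obtain ⟨γ, hγdef⟩ : ∃ γ : ℝ, γ = 1 / (2 * k ^ 2 * (1 + t * (k + 2))) := ⟨_, rfl⟩
  have hγ : 0 < γ := by rw [hγdef]; positivity
  have hγeq : γ * (k * (1 + t * (k + 2))) = 1 / (2 * k) := by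
    rw [hγdef]
    field_simp
  have hγk : k * γ ≤ 1 / (2 * k) := by
    rw [← hγeq]
    have : 0 ≤ γ * (k * (t * (k + 2))) := by positivity
    nlinarith
  have hhalf : 1 / (2 * (k : ℝ)) ≤ 1 / 2 := by
    apply one_div_le_one_div_of_le <;> linarith
  have hγ2 : γ ≤ 1 / 2 := by nlinarith
  refine ⟨γ, hγ, hγ2, ?_⟩
  have hlim : ∀ᶠ N : ℕ in atTop, (k + 1) * (2 * k) ^ k / γ ^ 2 ≤ (N : ℝ) ^ δ :=
    ((tendsto_rpow_atTop hδ).comp tendsto_natCast_atTop_atTop).eventually_ge_atTop _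
  filter_upwards [h, hlim, eventually_ge_atTop 1] with N h h1 hN V _ G hV hP hP' hdeg
  have hN0 : (0 : ℝ) < N := by exact_mod_cast hN
  by_cases hmany : (N : ℝ) ^ (((k + 1 : ℕ) : ℝ) - δ) ≤ (cliqueTuples G (k + 1)).card
  · obtain ⟨T, hT, -⟩ := h G hV hP _ (fun v hv => mem_cliqueTuples.1 hv) hmany
    exact Or.inl ⟨T, hT⟩
  right
  push Not at hmany
  have hKk : (1 / (2 * k) * (N : ℝ)) ^ k ≤ (cliqueTuples G k).card := by
    refine pow_le_card_cliqueTuples G (by positivity) hdeg k fun i hi => ?_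
    rw [hV]
    have hik : (i : ℝ) + 1 ≤ k := by exact_mod_cast hi
    have h2 : (i : ℝ) * (1 / k + γ) ≤ 1 - 1 / (2 * k) := by
      have h3 : (i : ℝ) * (1 / k) ≤ (k - 1) * (1 / k) := by
        gcongr
        linarith
      have h4 : (i : ℝ) * γ ≤ k * γ := by
        gcongr
      have h5 : ((k : ℝ) - 1) * (1 / k) = 1 - 2 * (1 / (2 * k)) := by
        field_simp
      linarith
    calc 1 / (2 * k) * (N : ℝ) ≤ (1 - i * (1 / k + γ)) * N := by gcongr; linarith
      _ = _ := by ring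
  have hne : (cliqueTuples G k).Nonempty := by
    rw [← Finset.card_pos]
    have : (0 : ℝ) < (cliqueTuples G k).card := lt_of_lt_of_le (by positivity) hKk
    exact_mod_cast this
  obtain ⟨B, hB, hB'⟩ := exists_almost_complete_parts G hk hγ (by linarith) (by omega)
    (by rwa [hV]) hne (by
      rw [hV]
      have h2 : (k + 1) * (2 * k : ℝ) ^ k ≤ (N : ℝ) ^ δ * γ ^ 2 := by
        rwa [div_le_iff₀ (by positivity)] at h1
      have h3 : (N : ℝ) ^ (((k + 1 : ℕ) : ℝ) - δ) * (N : ℝ) ^ δ = (N : ℝ) ^ (k + 1) := by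
        rw [← Real.rpow_add hN0, sub_add_cancel, Real.rpow_natCast]
      have h4 : (0 : ℝ) < (2 * k : ℝ) ^ k := by positivity
      have h5 : (N : ℝ) ^ k = (2 * k : ℝ) ^ k * (1 / (2 * k) * (N : ℝ)) ^ k := by
        rw [← mul_pow]
        congr 1
        field_simp
      refine le_of_mul_le_mul_left ?_ h4
      calc (2 * k : ℝ) ^ k * ((k + 1) * N * (cliqueTuples G (k + 1)).card)
          = ((k + 1) * (2 * k : ℝ) ^ k) * N * (cliqueTuples G (k + 1)).card := by ring
        _ ≤ ((N : ℝ) ^ δ * γ ^ 2) * N * (N : ℝ) ^ (((k + 1 : ℕ) : ℝ) - δ) := by gcongr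
        _ = ((N : ℝ) ^ (((k + 1 : ℕ) : ℝ) - δ) * (N : ℝ) ^ δ) * (γ ^ 2 * N) := by ring
        _ = (2 * k : ℝ) ^ k * (γ ^ 2 * N ^ 2 * (1 / (2 * k) * (N : ℝ)) ^ k) := by
            rw [h3, pow_succ, h5]
            ring
        _ ≤ _ := by gcongr)
  rw [hV] at hB hB'
  refine exists_isNClique_mul_of_almost_complete_parts (D := (k + 2) * γ * N) (by positivity)
    hP' B (fun i => le_trans (le_of_eq ?_) (hB i)) hB'
  have h6 : (N : ℝ) / (2 * k) = (1 / k - 1 / (2 * k)) * N := by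
    field_simp
    norm_num
  rw [h6, ← hγeq]
  ring

/-! ### Edge bounds from the independence number -/

open Classical in
theorem sum_card_adj_eq [Fintype V] (G : SimpleGraph V) :
    ∑ x, ((Finset.univ.filter (G.Adj x)).card : ℝ) = 2 * (G.edgeSet.ncard : ℝ) := by
  have h := G.sum_degrees_eq_twice_card_edges
  have h1 : G.edgeSet.ncard = G.edgeFinset.card := by
    rw [← SimpleGraph.coe_edgeFinset, Set.ncard_coe_finset]
  rw [h1]
  have h2 : ∀ x, Finset.univ.filter (G.Adj x) = G.neighborFinset x := by
    intro x; ext y; simp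
  simp_rw [h2, SimpleGraph.card_neighborFinset_eq_degree]
  exact_mod_cast h

open Classical in
/-- Pass to an induced subgraph of linear size with large minimum degree. -/
theorem exists_induced_degree {a η : ℝ} (ha : 0 ≤ a) (ha1 : a ≤ 1) (hη : 0 < η) :
    ∃ κ : ℝ, 0 < κ ∧ ∀ᶠ n : ℕ in atTop, ∀ G : SimpleGraph (Fin n),
      (a + η) * (n : ℝ) ^ 2 ≤ 2 * (G.edgeSet.ncard : ℝ) →
      ∃ W : Finset (Fin n), κ * n ≤ W.card ∧ ∀ x : W,
        ((Finset.univ.filter (fun y : W => ¬ G.Adj x y)).card : ℝ) ≤ (1 - a + η) * W.card := by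
  refine ⟨√η, Real.sqrt_pos.2 hη, ?_⟩
  have hlim : Tendsto (fun n : ℕ => η * √η * (n : ℝ)) atTop atTop :=
    tendsto_natCast_atTop_atTop.const_mul_atTop (by positivity)
  filter_upwards [hlim.eventually_ge_atTop (1 / 2)] with n hn G hG
  obtain ⟨W, hW, hW'⟩ := exists_subset_forall_le_degree G ha ha1 (η := η)
    (by rw [sum_card_adj_eq, Fintype.card_fin]; exact hG)
  rw [Fintype.card_fin] at hW
  have hcard : √η * n ≤ W.card := by
    refine le_of_pow_le_pow_left₀ two_ne_zero (Nat.cast_nonneg _) ?_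
    rwa [mul_pow, Real.sq_sqrt hη.le]
  refine ⟨W, hcard, fun x => ?_⟩
  have h1 := Finset.card_filter_add_card_filter_not (s := (Finset.univ : Finset W))
    (p := fun y : W => G.Adj x y)
  have h2 : (Finset.univ.filter (fun y : W => G.Adj x y)).card =
      (W.filter (G.Adj x)).card := by
    rw [← Finset.card_map (Function.Embedding.subtype (· ∈ W))]
    congr 1
    ext y
    simp only [Finset.mem_map, Finset.mem_filter, Finset.mem_univ, true_and,
      Function.Embedding.subtype_apply]
    constructor
    · rintro ⟨z, hz, rfl⟩
      exact ⟨z.2, hz⟩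
    · rintro ⟨hy, hxy⟩
      exact ⟨⟨y, hy⟩, hxy, rfl⟩
  rw [h2, Finset.card_univ, Fintype.card_coe] at h1
  have h3 : ((W.filter (G.Adj x)).card : ℝ) +
      ((Finset.univ.filter (fun y : W => ¬ G.Adj x y)).card : ℝ) = W.card := by exact_mod_cast h1
  have h4 := hW' x x.2
  have h5 : 1 / 2 ≤ η * W.card := by nlinarith
  linarith

theorem exists_isNClique_comap_subtype {G : SimpleGraph V} {W : Finset V} {t : ℕ} {U : Finset W}
    (h : ∃ C ⊆ U.map (.subtype (· ∈ W)), G.IsNClique t C) :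
    ∃ C ⊆ U, (G.comap (Function.Embedding.subtype (· ∈ W))).IsNClique t C := by
  classical
  obtain ⟨C, hC, hC'⟩ := h
  have hmem : ∀ x ∈ C, ∃ z ∈ U, (z : V) = x := fun x hx => by
    obtain ⟨z, hz, rfl⟩ := Finset.mem_map.1 (hC hx)
    exact ⟨z, hz, rfl⟩
  refine ⟨U.filter (fun z => (z : V) ∈ C), Finset.filter_subset _ _, ?_, ?_⟩
  · intro x hx y hy hxy
    simp only [Finset.coe_filter, Set.mem_ofPred_eq] at hx hy
    exact hC'.1 hx.2 hy.2 (fun h => hxy (Subtype.ext h))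
  · rw [← hC'.2, ← Finset.card_map (Function.Embedding.subtype (· ∈ W))]
    congr 1
    ext x
    simp only [Finset.mem_map, Finset.mem_filter, Function.Embedding.subtype_apply]
    constructor
    · rintro ⟨z, ⟨-, hz⟩, rfl⟩
      exact hz
    · intro hx
      obtain ⟨z, hz, rfl⟩ := hmem x hx
      exact ⟨z, ⟨hz, hx⟩, rfl⟩

theorem not_cliqueFree_of_comap_subtype {G : SimpleGraph V} {W : Finset V} {t : ℕ}
    (h : ∃ T : Finset W, (G.comap (Function.Embedding.subtype (· ∈ W))).IsNClique t T) :
    ¬ G.CliqueFree t := by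
  obtain ⟨T, hT⟩ := h
  exact fun hG => hG.comap (SimpleGraph.Embedding.comap _ G).isContained T hT

/-- Passing from sets of size `n ^ (1 - ε)` to sets measured by a linear-sized subset. -/
theorem eventually_forall_rpow_le {ε κ : ℝ} (hε : 0 < ε) (hε1 : ε ≤ 1) (hκ : 0 < κ) :
    ∀ᶠ n : ℕ in atTop, ∀ N : ℕ, κ * n ≤ N → (n : ℝ) ^ (1 - ε) ≤ (N : ℝ) ^ (1 - ε / 2) := by
  have hlim : ∀ᶠ n : ℕ in atTop, 1 / κ ^ (1 - ε / 2) ≤ (n : ℝ) ^ (ε / 2) :=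
    ((tendsto_rpow_atTop (half_pos hε)).comp tendsto_natCast_atTop_atTop).eventually_ge_atTop _
  filter_upwards [hlim, eventually_gt_atTop 0] with n h1 hn N hN
  have hn0 : (0 : ℝ) < n := by exact_mod_cast hn
  have hκ' : 0 < κ ^ (1 - ε / 2) := by positivity
  rw [div_le_iff₀ hκ'] at h1
  calc (n : ℝ) ^ (1 - ε) = (n : ℝ) ^ (1 - ε) * 1 := by ring
    _ ≤ (n : ℝ) ^ (1 - ε) * ((n : ℝ) ^ (ε / 2) * κ ^ (1 - ε / 2)) := by gcongr
    _ = ((n : ℝ) ^ (1 - ε) * (n : ℝ) ^ (ε / 2)) * κ ^ (1 - ε / 2) := by ring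
    _ = (κ * n) ^ (1 - ε / 2) := by
      rw [← Real.rpow_add hn0, Real.mul_rpow hκ.le hn0.le, mul_comm]
      ring_nf
    _ ≤ (N : ℝ) ^ (1 - ε / 2) := by
      refine Real.rpow_le_rpow (by positivity) hN (by linarith)

theorem eventually_forall_of_mul_le {P : ℕ → Prop} (hP : ∀ᶠ N in atTop, P N) {κ : ℝ}
    (hκ : 0 < κ) : ∀ᶠ n : ℕ in atTop, ∀ N : ℕ, κ * n ≤ N → P N := by
  obtain ⟨N₀, hN₀⟩ := eventually_atTop.1 hP
  have hlim : Tendsto (fun n : ℕ => κ * (n : ℝ)) atTop atTop :=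
    tendsto_natCast_atTop_atTop.const_mul_atTop hκ
  filter_upwards [hlim.eventually_ge_atTop (N₀ : ℝ)] with n hn N hN
  exact hN₀ N (by exact_mod_cast hn.trans hN)

/-- Under the gap conjecture, a graph whose independence number is below `Q t n` has
`(t - 1)`-cliques in all sets of almost full exponent. -/
theorem exists_forall_isNClique_of_indepNum_lt_Q {t : ℕ} (ht : 2 ≤ t)
    (hC : RamseyGapConjecture t) :
    ∃ ε : ℝ, 0 < ε ∧ ε ≤ 1 ∧ ∀ κ : ℝ, 0 < κ → ∀ᶠ n : ℕ in atTop, ∀ G : SimpleGraph (Fin n),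
      G.indepNum < Q t n → ∀ W : Finset (Fin n), κ * n ≤ W.card → ∀ U : Finset W,
        (W.card : ℝ) ^ (1 - ε) ≤ U.card →
        ∃ C ⊆ U, (G.comap (Function.Embedding.subtype (· ∈ W))).IsNClique (t - 1) C := by
  obtain ⟨ε₀, hε₀, h⟩ := eventually_ramseyNumber_Q_le_rpow ht hC
  obtain ⟨ε, hε, hε1, hle⟩ : ∃ ε : ℝ, 0 < ε ∧ ε ≤ 1 ∧ ε ≤ ε₀ :=
    ⟨min ε₀ 1, by positivity, min_le_right _ _, min_le_left _ _⟩
  refine ⟨ε / 2, by positivity, by linarith, fun κ hκ => ?_⟩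
  filter_upwards [h, eventually_forall_rpow_le hε hε1 hκ, eventually_ge_atTop 1] with
    n h1 h2 hn G hG W hW U hU
  have hn1 : (1 : ℝ) ≤ n := by exact_mod_cast hn
  refine exists_isNClique_comap_subtype (exists_isNClique_of_indepNum_lt hG _ ?_)
  rw [Finset.card_map]
  have h3 : (n : ℝ) ^ (1 - ε₀) ≤ (n : ℝ) ^ (1 - ε) :=
    Real.rpow_le_rpow_of_exponent_le hn1 (by linarith)
  exact_mod_cast h1.trans (h3.trans ((h2 _ hW).trans hU))

/-- Graphs with more edges than the Turán density and independence number below `Q t n` contain a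
clique on `(k + 1) (t - 1)` vertices. -/
theorem eventually_edges_lt_of_indepNum_lt_Q {t k : ℕ} (ht : 2 ≤ t) (hk : 0 < k)
    (hC : RamseyGapConjecture t) {c : ℝ} (hc : 0 < c) :
    ∀ᶠ n : ℕ in atTop, ∀ G : SimpleGraph (Fin n), G.CliqueFree ((k + 1) * (t - 1)) →
      G.indepNum < Q t n →
      2 * (G.edgeSet.ncard : ℝ) < (1 - 1 / k + c) * (n : ℝ) ^ 2 := by
  have hk1 : (1 : ℝ) ≤ k := by exact_mod_cast hk
  have hk0 : (0 : ℝ) < k := by linarith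
  have hinv : 1 / (k : ℝ) ≤ 1 := by rw [div_le_one hk0]; exact hk1
  have hinv0 : 0 < 1 / (k : ℝ) := by positivity
  -- With `a = 1 - 1/k + 2η` the edge hypothesis needs `a + η ≤ 1 - 1/k + c`, and non-degrees become
  -- at most `1 - a + η = 1/k - η`.
  obtain ⟨η, hη, hηk, hηc⟩ : ∃ η : ℝ, 0 < η ∧ 2 * η ≤ 1 / k ∧ 3 * η ≤ c :=
    ⟨min (1 / k / 2) (c / 3), by positivity,
      by linarith [min_le_left (1 / (k : ℝ) / 2) (c / 3)],
      by linarith [min_le_right (1 / (k : ℝ) / 2) (c / 3)]⟩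
  obtain ⟨ε, hε, hε1, hP⟩ := exists_forall_isNClique_of_indepNum_lt_Q ht hC
  obtain ⟨κ, hκ, hW⟩ := exists_induced_degree (a := 1 - 1 / k + 2 * η) (η := η) (by linarith)
    (by linarith) hη
  filter_upwards [hP κ hκ, hW, eventually_forall_of_mul_le
    (exists_isNClique_of_degree_gt hε hε1 hη (by linarith) (r := t - 1) (by omega) hk) hκ]
    with n hP hW hmain G hG hα
  by_contra! hlt
  obtain ⟨W, hWc, hWd⟩ := hW G
    (le_trans (mul_le_mul_of_nonneg_right (by linarith) (by positivity)) hlt)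
  refine not_cliqueFree_of_comap_subtype (hmain W.card hWc
    (G.comap (Function.Embedding.subtype (· ∈ W))) (Fintype.card_coe W) (hP G hα W hWc)
    fun x => (hWd x).trans (le_of_eq ?_)) hG
  ring

/-- With independence number `o(Q t n)`, the Turán density cannot be reached without a clique on
`(k + 1) (t - 1)` or `k t` vertices. -/
theorem exists_eventually_edges_lt_of_indepNum_lt_mul_Q {t k : ℕ} (ht : 2 ≤ t) (hk : 2 ≤ k)
    (hC : RamseyGapConjecture t) {φ : ℕ → ℝ} (hφ : Tendsto φ atTop (𝓝 0)) :
    ∃ c : ℝ, 0 < c ∧ ∀ᶠ n : ℕ in atTop, ∀ G : SimpleGraph (Fin n),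
      G.CliqueFree ((k + 1) * (t - 1)) → G.CliqueFree (k * t) →
      (G.indepNum : ℝ) < φ n * Q t n →
      2 * (G.edgeSet.ncard : ℝ) < (1 - 1 / k - c) * (n : ℝ) ^ 2 := by
  have hk1 : (2 : ℝ) ≤ k := by exact_mod_cast hk
  have hk0 : (0 : ℝ) < k := by linarith
  have hinv : 1 / (k : ℝ) ≤ 1 / 2 := one_div_le_one_div_of_le (by norm_num) hk1
  have hinv0 : 0 < 1 / (k : ℝ) := by positivity
  obtain ⟨ε, hε, hε1, hP⟩ := exists_forall_isNClique_of_indepNum_lt_Q ht hC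
  obtain ⟨γ, hγ, hγ2, hmain⟩ := exists_isNClique_of_degree_ge hε hε1 (r := t - 1) (by omega)
    (k := k) (by omega) t
  -- Here `a + η = 1 - 1/k - γ/2` and `1 - a + η = 1/k + γ`; the bound `γ ≤ 1/2` keeps `a ≥ 0`.
  obtain ⟨κ, hκ, hW⟩ := exists_induced_degree (a := 1 - 1 / k - 3 * γ / 4) (η := γ / 4)
    (by linarith) (by linarith) (by positivity)
  -- Sets of `|W|/(2k)` vertices then have at least `n/q` vertices, and eventually `φ n ≤ 1/q`.
  obtain ⟨q, hq⟩ := exists_nat_ge (2 * k / κ)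
  have hq0 : (0 : ℝ) < q := lt_of_lt_of_le (by positivity) hq
  refine ⟨γ / 2, by positivity, ?_⟩
  filter_upwards [hP κ hκ, hW, eventually_forall_of_mul_le hmain hκ,
    hφ.eventually_le_const (show (0 : ℝ) < 1 / q by positivity),
    hφ.eventually_le_const one_pos] with n hP hW hmain hφq hφ1 G hG hG' hα
  by_contra! hlt
  have hα' : G.indepNum < Q t n := by
    have : (G.indepNum : ℝ) < Q t n :=
      hα.trans_le (mul_le_of_le_one_left (Nat.cast_nonneg _) hφ1)
    exact_mod_cast this
  obtain ⟨W, hWc, hWd⟩ := hW G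
    (le_trans (mul_le_mul_of_nonneg_right (by linarith) (by positivity)) hlt)
  have hlin : ∀ U : Finset W, (W.card : ℝ) / (2 * k) ≤ U.card →
      ∃ C ⊆ U, (G.comap (Function.Embedding.subtype (· ∈ W))).IsNClique t C := by
    intro U hU
    refine exists_isNClique_comap_subtype
      (exists_isNClique_of_indepNum_lt_mul_Q (q := q) (x := φ n) ?_ hα _ ?_)
    · rwa [le_div_iff₀ hq0, mul_comm] at hφq
    · rw [Finset.card_map]
      have h1 : (n : ℝ) ≤ q * U.card := by
        rw [div_le_iff₀ hκ] at hq
        rw [div_le_iff₀ (by positivity)] at hU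
        have h2 : κ * n ≤ U.card * (2 * k) := hWc.trans hU
        have h3 : (U.card : ℝ) * (2 * k) ≤ U.card * (q * κ) := by gcongr
        nlinarith
      exact_mod_cast h1
  rcases hmain W.card hWc (G.comap (Function.Embedding.subtype (· ∈ W))) (Fintype.card_coe W)
    (hP G hα' W hWc) hlin (fun x => (hWd x).trans (le_of_eq (by ring))) with h | h
  · exact not_cliqueFree_of_comap_subtype h hG
  · exact not_cliqueFree_of_comap_subtype h hG'

/-! ### The join construction -/

/-- The join of copies of `F`: vertices of different colours `c` are adjacent, vertices of the same
colour are adjacent when their images under `p` are adjacent in `F`. -/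
def joinGraph (F : SimpleGraph W) {k : ℕ} (c : V → Fin k) (p : V → W) : SimpleGraph V where
  Adj x y := c x ≠ c y ∨ F.Adj (p x) (p y)
  symm := ⟨fun _ _ h => h.imp Ne.symm SimpleGraph.Adj.symm⟩
  loopless := ⟨fun _ h => h.elim (fun h => h rfl) (F.loopless.irrefl _)⟩

/-- Pigeonhole: more than `k (t - 1)` vertices of a clique put `t` into one colour, and these
project to a clique of `F`. -/
theorem cliqueFree_joinGraph {F : SimpleGraph W} {k t s : ℕ} {c : V → Fin k} {p : V → W}
    (hF : F.CliqueFree t) (hs : k * (t - 1) < s) : (joinGraph F c p).CliqueFree s := by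
  classical
  intro C hC
  have hlt : (Finset.univ : Finset (Fin k)).card * (t - 1) < C.card := by
    rw [hC.2]
    simpa using hs
  obtain ⟨i, -, hi⟩ := Finset.exists_lt_card_fiber_of_mul_lt_card_of_maps_to
    (f := c) (fun _ _ => Finset.mem_univ _) hlt
  have hadj : ∀ x ∈ C.filter (fun x => c x = i), ∀ y ∈ C.filter (fun x => c x = i), x ≠ y →
      F.Adj (p x) (p y) := by
    intro x hx y hy hxy
    rw [Finset.mem_filter] at hx hy
    exact (hC.1 hx.1 hy.1 hxy).resolve_left (fun h => h (hx.2.trans hy.2.symm))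
  have hinj : Set.InjOn p (C.filter (fun x => c x = i) : Set V) := by
    intro x hx y hy hxy
    by_contra hne
    exact (hadj x hx y hy hne).ne hxy
  refine hF.mono (by omega : t ≤ (C.filter (fun x => c x = i)).card)
    ((C.filter (fun x => c x = i)).image p) ⟨?_, Finset.card_image_of_injOn hinj⟩
  intro x hx y hy hxy
  obtain ⟨x, hx', rfl⟩ := Finset.mem_image.1 hx
  obtain ⟨y, hy', rfl⟩ := Finset.mem_image.1 hy
  exact hadj x hx' y hy' (fun h => hxy (by rw [h]))

/-- An independent set is monochromatic, so it projects injectively into `F`. -/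
theorem indepNum_joinGraph_le [Finite V] [Finite W] {F : SimpleGraph W} {k : ℕ} {c : V → Fin k}
    {p : V → W} (hinj : ∀ x y, c x = c y → p x = p y → x = y) :
    (joinGraph F c p).indepNum ≤ F.indepNum := by
  classical
  obtain ⟨I, hI⟩ := (joinGraph F c p).exists_isNIndepSet_indepNum
  have hcol : ∀ x ∈ I, ∀ y ∈ I, c x = c y := by
    intro x hx y hy
    by_contra h
    exact hI.1 hx hy (fun h' => h (by rw [h'])) (Or.inl h)
  have hinj' : Set.InjOn p (I : Set V) := fun x hx y hy h => hinj x y (hcol x hx y hy) h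
  rw [← hI.2, ← Finset.card_image_of_injOn hinj']
  refine SimpleGraph.IsIndepSet.card_le_indepNum ?_
  intro x hx y hy hxy
  obtain ⟨x, hx', rfl⟩ := Finset.mem_image.1 hx
  obtain ⟨y, hy', rfl⟩ := Finset.mem_image.1 hy
  exact fun h => hI.1 hx' hy' (fun h => hxy (by rw [h])) (Or.inr h)

theorem le_two_mul_edges_joinGraph [Fintype V] [Fintype W] {F : SimpleGraph W} {k : ℕ}
    {c : V → Fin k} {p : V → W} (hinj : ∀ x y, c x = c y → p x = p y → x = y) :
    (Fintype.card V : ℝ) * (Fintype.card V - Fintype.card W) ≤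
      2 * ((joinGraph F c p).edgeSet.ncard : ℝ) := by
  classical
  rw [← sum_card_adj_eq]
  have h : ∀ x, (Fintype.card V : ℝ) - Fintype.card W ≤
      ((Finset.univ.filter ((joinGraph F c p).Adj x)).card : ℝ) := by
    intro x
    have h1 := Finset.card_filter_add_card_filter_not (s := (Finset.univ : Finset V))
      (p := (joinGraph F c p).Adj x)
    have h2 : (Finset.univ.filter (fun y => ¬ (joinGraph F c p).Adj x y)).card ≤
        Fintype.card W := by
      rw [← Finset.card_univ (α := W)]
      refine Finset.card_le_card_of_injOn p (fun _ _ => Finset.mem_coe.2 (Finset.mem_univ _)) ?_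
      intro y hy z hz hyz
      have hcol : ∀ w, ¬ (joinGraph F c p).Adj x w → c x = c w := fun w hw => by
        by_contra h
        exact hw (Or.inl h)
      simp only [Finset.coe_filter, Finset.mem_univ, true_and, Set.mem_ofPred_eq] at hy hz
      exact hinj y z ((hcol y hy).symm.trans (hcol z hz)) hyz
    rw [Finset.card_univ] at h1
    have h3 : ((Finset.univ.filter ((joinGraph F c p).Adj x)).card : ℝ) +
      (Finset.univ.filter (fun y => ¬ (joinGraph F c p).Adj x y)).card = Fintype.card V := by
      exact_mod_cast h1
    have h4 : ((Finset.univ.filter (fun y => ¬ (joinGraph F c p).Adj x y)).card : ℝ) ≤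
      Fintype.card W := by exact_mod_cast h2
    linarith
  calc (Fintype.card V : ℝ) * (Fintype.card V - Fintype.card W)
      = ∑ _x : V, ((Fintype.card V : ℝ) - Fintype.card W) := by simp; ring
    _ ≤ ∑ x, ((Finset.univ.filter ((joinGraph F c p).Adj x)).card : ℝ) :=
      Finset.sum_le_sum fun x _ => h x
    _ = _ := by congr!

/-- The lower-bound construction: a join of `k` extremal `K_t`-free graphs. -/
theorem eventually_exists_edges_ge {t k s : ℕ} (ht : 2 ≤ t) (hk : 2 ≤ k)
    (hC : RamseyGapConjecture t) (hs : k * (t - 1) < s) {c : ℝ} (hc : 0 < c) :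
    ∀ᶠ n : ℕ in atTop, ∃ G : SimpleGraph (Fin n), G.CliqueFree s ∧ G.indepNum < Q t n ∧
      (1 - 1 / k - c) * (n : ℝ) ^ 2 ≤ 2 * (G.edgeSet.ncard : ℝ) := by
  have hlim : Tendsto (fun n : ℕ => c * (n : ℝ)) atTop atTop :=
    tendsto_natCast_atTop_atTop.const_mul_atTop hc
  filter_upwards [eventually_Q_div_lt ht hk hC, hlim.eventually_ge_atTop 1] with n hQ hn
  obtain ⟨F, hF, hF'⟩ := exists_indepNum_eq_Q ht (n / k + 1)
  -- Residue and quotient modulo `k` place `Fin n` inside `k` copies of the vertex set of `F`.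
  let col : Fin n → Fin k := fun i => ⟨i.val % k, Nat.mod_lt _ (by omega)⟩
  let p : Fin n → Fin (n / k + 1) := fun i =>
    ⟨i.val / k, Nat.lt_succ_of_le (Nat.div_le_div_right i.2.le)⟩
  have hinj : ∀ x y, col x = col y → p x = p y → x = y := by
    intro x y h1 h2
    simp only [col, p, Fin.mk.injEq] at h1 h2
    ext
    rw [← Nat.div_add_mod x.val k, ← Nat.div_add_mod y.val k, h1, h2]
  refine ⟨joinGraph F col p, cliqueFree_joinGraph hF hs,
    (indepNum_joinGraph_le hinj).trans_lt (hF'.symm ▸ hQ),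
    le_trans ?_ (le_two_mul_edges_joinGraph hinj)⟩
  simp only [Fintype.card_fin]
  have h1 : ((n / k + 1 : ℕ) : ℝ) ≤ n / k + 1 := by
    push_cast
    linarith [Nat.cast_div_le (α := ℝ) (m := n) (n := k)]
  have h2 : (0 : ℝ) ≤ n := Nat.cast_nonneg n
  calc (1 - 1 / k - c) * (n : ℝ) ^ 2 = n * (n - (n / k + c * n)) := by ring
    _ ≤ n * (n - ((n / k + 1 : ℕ) : ℝ)) := by gcongr; linarith

/-! ### From edge bounds to densities -/

theorem two_mul_edges_le [Fintype V] (G : SimpleGraph V) :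
    2 * (G.edgeSet.ncard : ℝ) ≤ (Fintype.card V : ℝ) ^ 2 := by
  classical
  rw [← sum_card_adj_eq]
  calc ∑ x, ((Finset.univ.filter (G.Adj x)).card : ℝ) ≤ ∑ _x : V, (Fintype.card V : ℝ) :=
        Finset.sum_le_sum fun x _ => by exact_mod_cast Finset.card_le_univ _
    _ = _ := by simp [sq]

theorem free_completeGraph_iff {G : SimpleGraph V} {s : ℕ} :
    (SimpleGraph.completeGraph (Fin s)).Free G ↔ G.CliqueFree s := by
  have h := SimpleGraph.cliqueFree_iff_top_free (G := G) (β := Fin s)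
  rw [Fintype.card_fin] at h
  exact h.symm

theorem bddAbove_edges {U : Type*} (H : SimpleGraph U) (n : ℕ) (x : ℝ) :
    BddAbove {e : ℕ | ∃ G : SimpleGraph (Fin n),
      H.Free G ∧ (G.indepNum : ℝ) < x ∧ G.edgeSet.ncard = e} := by
  refine ⟨n ^ 2, ?_⟩
  rintro e ⟨G, -, -, rfl⟩
  have h := two_mul_edges_le G
  rw [Fintype.card_fin] at h
  have h0 : (0 : ℝ) ≤ G.edgeSet.ncard := Nat.cast_nonneg _
  have h1 : (G.edgeSet.ncard : ℝ) ≤ (n : ℝ) ^ 2 := by linarith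
  exact_mod_cast h1

theorem edges_le_RT {n s : ℕ} {x : ℝ} {G : SimpleGraph (Fin n)} (hG : G.CliqueFree s)
    (hx : (G.indepNum : ℝ) < x) :
    G.edgeSet.ncard ≤ RT n (SimpleGraph.completeGraph (Fin s)) x :=
  le_csSup (bddAbove_edges _ _ _) ⟨G, free_completeGraph_iff.2 hG, hx, rfl⟩

/-- Nonnegativity of `b` covers the case of no admissible graph, where `RT` is `0`. -/
theorem two_mul_RT_le {n s : ℕ} {x b : ℝ} (hb : 0 ≤ b)
    (h : ∀ G : SimpleGraph (Fin n), G.CliqueFree s → (G.indepNum : ℝ) < x →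
      2 * (G.edgeSet.ncard : ℝ) ≤ b) :
    2 * (RT n (SimpleGraph.completeGraph (Fin s)) x : ℝ) ≤ b := by
  rcases Set.eq_empty_or_nonempty {e : ℕ | ∃ G : SimpleGraph (Fin n),
    (SimpleGraph.completeGraph (Fin s)).Free G ∧ (G.indepNum : ℝ) < x ∧
      G.edgeSet.ncard = e} with he | hne
  · rw [RT, he]
    simpa using hb
  · obtain ⟨G, hG, hx, he⟩ := Nat.sSup_mem hne (bddAbove_edges _ _ _)
    rw [RT, ← he]
    exact h G (free_completeGraph_iff.1 hG) hx

theorem RT_div_sq_le_one (n s : ℕ) (x : ℝ) :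
    (RT n (SimpleGraph.completeGraph (Fin s)) x : ℝ) / (n : ℝ) ^ 2 ≤ 1 := by
  have h := two_mul_RT_le (n := n) (s := s) (x := x) (b := (n : ℝ) ^ 2) (by positivity)
    fun G _ _ => by simpa using two_mul_edges_le G
  refine div_le_one_of_le₀ ?_ (by positivity)
  have : (0 : ℝ) ≤ RT n (SimpleGraph.completeGraph (Fin s)) x := Nat.cast_nonneg _
  linarith

section Densities

variable (s : ℕ) (f : ℕ → ℝ)

theorem isBoundedUnder_le_RT : IsBoundedUnder (· ≤ ·) atTop
    (fun n : ℕ => (RT n (SimpleGraph.completeGraph (Fin s)) (f n) : ℝ) / (n : ℝ) ^ 2) :=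
  isBoundedUnder_of ⟨1, fun n => RT_div_sq_le_one n s (f n)⟩

theorem isBoundedUnder_ge_RT : IsBoundedUnder (· ≥ ·) atTop
    (fun n : ℕ => (RT n (SimpleGraph.completeGraph (Fin s)) (f n) : ℝ) / (n : ℝ) ^ 2) :=
  isBoundedUnder_of ⟨0, fun n => by positivity⟩

theorem lowerDensity_le_upperDensity :
    lowerDensity (SimpleGraph.completeGraph (Fin s)) f ≤
      upperDensity (SimpleGraph.completeGraph (Fin s)) f :=
  liminf_le_limsup (isBoundedUnder_le_RT s f) (isBoundedUnder_ge_RT s f)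

variable {s f}

theorem upperDensity_le {a : ℝ} (ha : 0 ≤ a)
    (h : ∀ᶠ n : ℕ in atTop, ∀ G : SimpleGraph (Fin n), G.CliqueFree s →
      (G.indepNum : ℝ) < f n → 2 * (G.edgeSet.ncard : ℝ) ≤ a * (n : ℝ) ^ 2) :
    upperDensity (SimpleGraph.completeGraph (Fin s)) f ≤ a / 2 := by
  refine limsup_le_of_le (isBoundedUnder_ge_RT s f).isCoboundedUnder_le ?_
  filter_upwards [h] with n hn
  refine div_le_of_le_mul₀ (by positivity) (by positivity) ?_
  have := two_mul_RT_le (by positivity) hn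
  linarith

theorem le_lowerDensity {a : ℝ}
    (h : ∀ᶠ n : ℕ in atTop, ∃ G : SimpleGraph (Fin n), G.CliqueFree s ∧
      (G.indepNum : ℝ) < f n ∧ a * (n : ℝ) ^ 2 ≤ 2 * (G.edgeSet.ncard : ℝ)) :
    a / 2 ≤ lowerDensity (SimpleGraph.completeGraph (Fin s)) f := by
  refine le_liminf_of_le (isBoundedUnder_le_RT s f).isCoboundedUnder_ge ?_
  filter_upwards [h, eventually_gt_atTop 0] with n ⟨G, hG, hx, he⟩ hn
  have hn0 : (0 : ℝ) < n := by exact_mod_cast hn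
  rw [le_div_iff₀ (by positivity)]
  have h1 : (G.edgeSet.ncard : ℝ) ≤ RT n (SimpleGraph.completeGraph (Fin s)) (f n) := by
    exact_mod_cast edges_le_RT hG hx
  linarith

theorem lowerDensity_nonneg : 0 ≤ lowerDensity (SimpleGraph.completeGraph (Fin s)) f :=
  le_liminf_of_le (isBoundedUnder_le_RT s f).isCoboundedUnder_ge
    (Eventually.of_forall fun n => by positivity)

end Densities

/-! ### Densities of cliques at `Q` and below, and the theorem -/

theorem one_sub_one_div_nonneg {k : ℕ} (hk : 0 < k) : (0 : ℝ) ≤ 1 - 1 / k := by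
  have h : (1 : ℝ) ≤ k := by exact_mod_cast hk
  rw [sub_nonneg, div_le_one (by linarith)]
  exact h

theorem upperDensity_Q_le {s t k : ℕ} (ht : 2 ≤ t) (hk : 0 < k) (hC : RamseyGapConjecture t)
    (hs : s ≤ (k + 1) * (t - 1)) :
    upperDensity (SimpleGraph.completeGraph (Fin s)) (fun n => (Q t n : ℝ)) ≤
      (1 - 1 / k) / 2 := by
  refine le_of_forall_pos_le_add fun c hc => ?_
  have hk' := one_sub_one_div_nonneg hk
  refine (upperDensity_le (a := 1 - 1 / k + 2 * c) (by linarith) ?_).trans (by linarith)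
  filter_upwards [eventually_edges_lt_of_indepNum_lt_Q ht hk hC (c := 2 * c) (by linarith)] with
    n hn G hG hα
  exact (hn G (hG.mono hs) (by exact_mod_cast hα)).le

theorem le_lowerDensity_Q {s t k : ℕ} (ht : 2 ≤ t) (hk : 2 ≤ k) (hC : RamseyGapConjecture t)
    (hs : k * (t - 1) < s) :
    (1 - 1 / k) / 2 ≤
      lowerDensity (SimpleGraph.completeGraph (Fin s)) (fun n => (Q t n : ℝ)) := by
  refine le_of_forall_sub_le fun c hc => ?_
  refine le_trans (by linarith) (le_lowerDensity (a := 1 - 1 / k - 2 * c) ?_)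
  filter_upwards [eventually_exists_edges_ge ht hk hC hs (c := 2 * c) (by linarith)] with
    n ⟨G, hG, hα, he⟩
  exact ⟨G, hG, by exact_mod_cast hα, he⟩

theorem upperDensity_mul_Q_lt {s t k : ℕ} (ht : 2 ≤ t) (hk : 2 ≤ k)
    (hC : RamseyGapConjecture t) (hs : s ≤ (k + 1) * (t - 1)) (hs' : s ≤ k * t) {φ : ℕ → ℝ}
    (hφ : Tendsto φ atTop (𝓝 0)) :
    upperDensity (SimpleGraph.completeGraph (Fin s)) (fun n => φ n * (Q t n : ℝ)) <
      (1 - 1 / k) / 2 := by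
  obtain ⟨c, hc, h⟩ := exists_eventually_edges_lt_of_indepNum_lt_mul_Q ht hk hC hφ
  have hk1 : (2 : ℝ) ≤ k := by exact_mod_cast hk
  have hinv : 1 / (k : ℝ) ≤ 1 / 2 := one_div_le_one_div_of_le (by norm_num) hk1
  -- The constant `c` may exceed `1 - 1/k`; truncating at `0` keeps the bound strict because `k ≥
  -- 2`.
  refine (upperDensity_le (a := max 0 (1 - 1 / k - c)) (le_max_left _ _) ?_).trans_lt ?_
  · filter_upwards [h] with n hn G hG hα
    refine (hn G (hG.mono hs) (hG.mono hs') hα).le.trans ?_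
    gcongr
    exact le_max_right _ _
  · have : max 0 (1 - 1 / k - c) < 1 - 1 / (k : ℝ) := max_lt (by linarith) (by linarith)
    linarith

end RamseyTuran

theorem mainTheorem10 (s t : ℕ) (ht : 2 ≤ t)
    (hconj : RamseyTuran.RamseyGapConjecture t)
    (hconj' : RamseyTuran.RamseyGapConjecture (t + 1))
    (hpt : RamseyTuran.HasPhaseTransition (SimpleGraph.completeGraph (Fin s))
      (fun n => (RamseyTuran.Q t n : ℝ)) (fun n => (RamseyTuran.Q (t + 1) n : ℝ))) :
    RamseyTuran.HasStrongPhaseTransition (SimpleGraph.completeGraph (Fin s))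
      (fun n => (RamseyTuran.Q t n : ℝ)) := by
  obtain ⟨-, hlt⟩ := hpt
  have hlu := RamseyTuran.lowerDensity_le_upperDensity s (fun n => (RamseyTuran.Q t n : ℝ))
  have hlu' := RamseyTuran.lowerDensity_le_upperDensity s
    (fun n => (RamseyTuran.Q (t + 1) n : ℝ))
  -- Otherwise the upper bound with `k = 1` makes the density at `Q t n` zero, leaving no room for a
  -- transition.
  have hs2 : 2 * (t - 1) < s := by
    by_contra! h
    have h1 := RamseyTuran.upperDensity_Q_le ht one_pos hconj h
    have h2 := RamseyTuran.lowerDensity_nonneg (s := s)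
      (f := fun n => (RamseyTuran.Q (t + 1) n : ℝ))
    norm_num at h1
    linarith
  obtain ⟨k, hk, hks, hsk⟩ : ∃ k : ℕ, 2 ≤ k ∧ k * (t - 1) < s ∧ s ≤ (k + 1) * (t - 1) := by
    refine ⟨(s - 1) / (t - 1), ?_, ?_, ?_⟩
    · rw [Nat.le_div_iff_mul_le (by omega)]
      omega
    · have := Nat.div_mul_le_self (s - 1) (t - 1)
      omega
    · have := Nat.lt_mul_div_succ (s - 1) (show 0 < t - 1 by omega)
      rw [mul_comm] at this
      omega
  have hupper := RamseyTuran.upperDensity_Q_le ht (by omega) hconj hsk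
  -- Otherwise the construction for `t + 1`, whose threshold is `k ((t + 1) - 1) = k t`, attains the
  -- same value at `Q (t + 1) n`.
  have hst : s ≤ k * t := by
    by_contra! h
    have := RamseyTuran.le_lowerDensity_Q (by omega) hk hconj' (by simpa using h)
    linarith
  intro φ hφ
  refine ⟨?_, (RamseyTuran.upperDensity_mul_Q_lt ht hk hconj hsk hst hφ).trans_le
    (RamseyTuran.le_lowerDensity_Q ht hk hconj hks)⟩
  filter_upwards [hφ.eventually_le_const one_pos] with n hn
  exact mul_le_of_le_one_left (Nat.cast_nonneg _) hn
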